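/- **Setting.** A graph with cardinal preferences $(G,\mathsf{sat})$ consists of a finite graph $G=(V,E)$ without isolated vertices and a function $\mathsf{sat}\colon V\times V\to\mathbb R_{\ge 0}$ with $\mathsf{sat}(u,u)=0$ for all $u$, such that $\{u,v\}\in E$ iff $\mathsf{sat}(u,v)>0$ or $\mathsf{sat}(v,u)>0$. It has *strict preferences* if $\mathsf{sat}(v,x)\ne\mathsf{sat}(v,y)$ for every $v$ and any two distinct neighbours $x,y$ of $v$. A (fractional) matching is a map $M\colon E\to\mathbb R_{\ge0}$ with $\sum_{u\in N(v)}M(v,u)\le 1$ for every $v$; the agent $v$ is *matched* if this sum is positive and *fully matched* if it equals $1$. Put $M(x,\succeq y)=\sum M(x,z)$ over all $z\in N(x)$ with $\mathsf{sat}(x,z)\ge\mathsf{sat}(x,y)$. $M$ is *ordinally stable* (an OSM) if no edge $\{u,v\}$ satisfies both $M(u,\succeq v)<1$ and $M(v,\succeq u)<1$. A *stable partition* is a permutation $\pi$ of $V$ such that for all $v\in V$: if $\pi(v)\neq v$ then $\{v,\pi(v)\}\in E$; if $\pi(v)\ne\pi^{-1}(v)$ then $\mathsf{sat}(v,\pi(v))>\mathsf{sat}(v,\pi^{-1}(v))$;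 and for each neighbour $w$ of $v$, if $\pi(v)=v$ or $\mathsf{sat}(v,w)>\mathsf{sat}(v,\pi^{-1}(v))$, then $\mathsf{sat}(w,\pi^{-1}(w))\ge\mathsf{sat}(w,v)$. The agent $v$ is a *singleton* of $\pi$ if $\pi(v)=v$. The matching $M^\pi$ has value $1$ on the edges $\{v,\pi(v)\}$ with $\pi(v)=\pi^{-1}(v)\neq v$, value $1/2$ on the edges $\{v,\pi(v)\}$ with $\pi(v)\neq\pi^{-1}(v)$, and value $0$ on all other edges. *Max-Full OSM* is the decision problem: given $(G,\mathsf{sat})$ with rational $\mathsf{sat}$ and $\tau\in\mathbb N$, is there an OSM with at least $\tau$ fully matched agents? **Lemma.** (A) For graphs with strict preferences, Max-Full OSM can be solved in $O(n^2)$ time, where $n=|V|\geq 1$, on a word RAM (words of $O(\log n)$ bits; $+$, truncated $-$, $\times$, integer division, comparisons and indirect memory access at unit cost) if every input number fits into $O(1)$ words of $\log_2 n$ bits. More precisely, there are one program and one constant $K$ such that for every $c\in\mathbb N$ and every instance with strict preferences in which $\tau$ and the numerators and denominators of all values $\mathsf{sat}(u,v)$, as given in the input, are at most $n^c$, the program decides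 the instance correctly within $K(c+1)n^2$ steps, using only numbers of size at most $n^{K(c+1)}$. (B) Let $(G,\mathsf{sat})$ have strict preferences. Then a stable partition exists, and for every OSM $M$: 1. $M(x,\succeq y)=1$ whenever $x$ is the most preferred neighbour of $y$; 2. for every agent $y$ and every stable partition $\pi$, the following are equivalent: $y$ is matched in $M$; $y$ is fully matched in $M$; $y$ is not a singleton of $\pi$. Moreover, for every stable partition $\pi$, the matching $M^\pi$ is an OSM, and no OSM has more fully matched agents than $M^\pi$. -/

import Mathlib

open scoped BigOperators

universe u

/-- A graph with cardinal preferences: `sat u v` is the satisfaction of agent `u` towards agent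
`v`; the edges are exactly the pairs for which at least one satisfaction is positive, and no agent
is isolated. -/
structure PrefGraph (V : Type u) where
  /-- the acceptability graph -/
  G : SimpleGraph V
  /-- the satisfaction function -/
  sat : V → V → ℝ
  sat_nonneg : ∀ u v, 0 ≤ sat u v
  sat_self : ∀ u, sat u u = 0
  adj_iff : ∀ u v, G.Adj u v ↔ 0 < sat u v ∨ 0 < sat v u
  no_isolated : ∀ v, ∃ u, G.Adj v u

namespace PrefGraph

/-- No agent is indifferent between two different neighbours. -/
def Strict {V : Type u} (I : PrefGraph V) : Prop :=
  ∀ v x y, I.G.Adj v x → I.G.Adj v y → x ≠ y → I.sat v x ≠ I.sat v y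

/-- `x` is a most preferred agent of `y`. -/
def MostPreferred {V : Type u} (I : PrefGraph V) (y x : V) : Prop :=
  I.G.Adj y x ∧ ∀ z, I.G.Adj y z → I.sat y z ≤ I.sat y x

open Classical in
/-- The total weight `∑_{u ∈ N(v)} M(v,u)` at the agent `v`. -/
noncomputable def load {V : Type u} [Fintype V] (I : PrefGraph V) (M : V → V → ℝ) (v : V) : ℝ :=
  ∑ u ∈ Finset.univ.filter (fun u => I.G.Adj v u), M v u

/-- Fractional matchings: non-negative edge weights (a symmetric function, extended by zero to the
non-edges) with total weight at most `1` at every agent. -/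
structure IsMatching {V : Type u} [Fintype V] (I : PrefGraph V) (M : V → V → ℝ) : Prop where
  symm : ∀ u v, M u v = M v u
  nonneg : ∀ u v, 0 ≤ M u v
  support : ∀ u v, ¬ I.G.Adj u v → M u v = 0
  load_le : ∀ v, I.load M v ≤ 1

/-- `v` is matched under `M`. -/
def Matched {V : Type u} [Fintype V] (I : PrefGraph V) (M : V → V → ℝ) (v : V) : Prop :=
  0 < I.load M v

/-- `v` is fully matched under `M`. -/
def FullyMatched {V : Type u} [Fintype V] (I : PrefGraph V) (M : V → V → ℝ) (v : V) : Prop :=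
  I.load M v = 1

/-- The number of fully matched agents. -/
noncomputable def numFully {V : Type u} [Fintype V] (I : PrefGraph V) (M : V → V → ℝ) : ℕ :=
  {v | I.FullyMatched M v}.ncard

open Classical in
/-- `M(x, ⪰ y)`: the total weight between `x` and the neighbours that `x` weakly prefers to `y`. -/
noncomputable def loadGe {V : Type u} [Fintype V] (I : PrefGraph V) (M : V → V → ℝ)
    (x y : V) : ℝ :=
  ∑ z ∈ Finset.univ.filter (fun z => I.G.Adj x z ∧ I.sat x y ≤ I.sat x z), M x z

/-- The pair `{u, v}` is an ordinally blocking pair of `M`. -/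
def OrdBlocking {V : Type u} [Fintype V] (I : PrefGraph V) (M : V → V → ℝ) (u v : V) : Prop :=
  I.G.Adj u v ∧ I.loadGe M u v < 1 ∧ I.loadGe M v u < 1

/-- Ordinally stable (fractional) matchings. -/
def IsOSM {V : Type u} [Fintype V] (I : PrefGraph V) (M : V → V → ℝ) : Prop :=
  I.IsMatching M ∧ ∀ u v, ¬ I.OrdBlocking M u v

/-- Stable partitions. An agent `v` with `π v = v` is a singleton of `π`. -/
structure IsStablePartition {V : Type u} (I : PrefGraph V) (π : Equiv.Perm V) : Prop where
  adj : ∀ v, π v ≠ v → I.G.Adj v (π v)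
  cycle : ∀ v, π v ≠ π.symm v → I.sat v (π.symm v) < I.sat v (π v)
  stable : ∀ v w, I.G.Adj v w → (π v = v ∨ I.sat v (π.symm v) < I.sat v w) →
    I.sat w v ≤ I.sat w (π.symm w)

/-- YES-instances of the decision problem Max-Full OSM. -/
def MaxFullOSM {V : Type u} [Fintype V] (I : PrefGraph V) (τ : ℕ) : Prop :=
  ∃ M : V → V → ℝ, I.IsOSM M ∧ τ ≤ I.numFully M

end PrefGraph

open Classical in
/-- The matching `M^π` of a partition `π`: weight `1` on the transpositions of `π`, weight `1/2`
on the edges `{v, π v}` of its longer cycles, and weight `0` elsewhere. -/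
noncomputable def partitionMatching {V : Type u} (π : Equiv.Perm V) (u v : V) : ℝ :=
  if u = v then 0
  else if π u = v ∧ π v = u then 1
  else if π u = v ∨ π v = u then 1 / 2
  else 0

namespace WordRAM

/-- The state of a word RAM: registers (named in the program) and an indirectly addressed
memory. -/
structure State where
  reg : ℕ → ℕ
  mem : ℕ → ℕ

/-- Arithmetic operations (truncated subtraction, integer division). -/
inductive ArithOp where
  | add | sub | mul | div

/-- The value of an arithmetic operation. -/
def ArithOp.eval : ArithOp → ℕ → ℕ → ℕ
  | .add, a, b => a + b
  | .sub, a, b => a - b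
  | .mul, a, b => a * b
  | .div, a, b => a / b

/-- RAM programs with structured control flow. -/
inductive Program where
  /-- `r_d := k` -/
  | const (d k : ℕ)
  /-- `r_d := r_a op r_b` -/
  | arith (op : ArithOp) (d a b : ℕ)
  /-- `r_d := mem[r_a]` -/
  | load (d a : ℕ)
  /-- `mem[r_a] := r_b` -/
  | store (a b : ℕ)
  /-- run the two programs one after the other -/
  | seq (p q : Program)
  /-- if `r_a < r_b` run `p`, otherwise run `q` -/
  | ite (a b : ℕ) (p q : Program)
  /-- as long as `r_a < r_b`, run `p` -/
  | while (a b : ℕ) (p : Program)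

/-- Write the value `k` into the register `d`. -/
def State.setReg (s : State) (d k : ℕ) : State :=
  { s with reg := Function.update s.reg d k }

/-- Write the value `k` into the memory cell `i`. -/
def State.setMem (s : State) (i k : ℕ) : State :=
  { s with mem := Function.update s.mem i k }

/-- `Exec W p s t s'`: on a machine whose words hold the numbers `0, …, W`, the program `p`, started
in the state `s`, halts after exactly `t` steps in the state `s'`. Every assignment and every test
is one step. There is no rule for an overflow and none for a division by zero: a program that meets
one of these gets stuck. -/
inductive Exec (W : ℕ) : Program → State → ℕ → State → Prop where
  | const (s : State) (d k : ℕ) (hk : k ≤ W) :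
      Exec W (.const d k) s 1 (s.setReg d k)
  | arith (s : State) (op : ArithOp) (d a b : ℕ) (h0 : op = .div → s.reg b ≠ 0)
      (h : op.eval (s.reg a) (s.reg b) ≤ W) :
      Exec W (.arith op d a b) s 1 (s.setReg d (op.eval (s.reg a) (s.reg b)))
  | load (s : State) (d a : ℕ) :
      Exec W (.load d a) s 1 (s.setReg d (s.mem (s.reg a)))
  | store (s : State) (a b : ℕ) :
      Exec W (.store a b) s 1 (s.setMem (s.reg a) (s.reg b))
  | seq {p q : Program} {s₁ s₂ s₃ : State} {t₁ t₂ : ℕ}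
      (h₁ : Exec W p s₁ t₁ s₂) (h₂ : Exec W q s₂ t₂ s₃) :
      Exec W (.seq p q) s₁ (t₁ + t₂) s₃
  | ite_true {a b : ℕ} {p q : Program} {s s' : State} {t : ℕ}
      (hc : s.reg a < s.reg b) (h : Exec W p s t s') :
      Exec W (.ite a b p q) s (t + 1) s'
  | ite_false {a b : ℕ} {p q : Program} {s s' : State} {t : ℕ}
      (hc : ¬ s.reg a < s.reg b) (h : Exec W q s t s') :
      Exec W (.ite a b p q) s (t + 1) s'
  | while_done {a b : ℕ} {p : Program} {s : State} (hc : ¬ s.reg a < s.reg b) :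
      Exec W (.while a b p) s 1 s
  | while_loop {a b : ℕ} {p : Program} {s₁ s₂ s₃ : State} {t₁ t₂ : ℕ}
      (hc : s₁.reg a < s₁.reg b) (h₁ : Exec W p s₁ t₁ s₂)
      (h₂ : Exec W (.while a b p) s₂ t₂ s₃) :
      Exec W (.while a b p) s₁ (t₁ + t₂ + 1) s₃

/-- The entry in row `i` and column `j` of a matrix, and `0` outside of the matrix. -/
def entry {n : ℕ} (A : Fin n → Fin n → ℕ) (i j : ℕ) : ℕ :=
  if h : i < n ∧ j < n then A ⟨i, h.1⟩ ⟨j, h.2⟩ else 0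

/-- The input of Max-Full OSM with the agents `0, …, n - 1`, the satisfactions
`num u v / den u v` and the threshold `τ`: register `0` holds `n`, register `1` holds `τ`, the memory
cells `2 (u n + v)` and `2 (u n + v) + 1` hold `num u v` and `den u v`, and everything else is `0`.
The edges are not listed, as the satisfactions determine them. -/
def inputState (n τ : ℕ) (num den : Fin n → Fin n → ℕ) : State where
  reg := fun r => if r = 0 then n else if r = 1 then τ else 0
  mem := fun i => if i % 2 = 0 then entry num (i / 2 / n) (i / 2 % n)
    else entry den (i / 2 / n) (i / 2 % n)

end WordRAM

/-!
Everything rests on comparing two ordinally stable matchings `M` and `M'`. At every edge, `M'`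
saturates one end by neighbours at least as good as the other end. Weighting the edges with `M`,
and with the roles exchanged with `M'`, and counting at each agent which of its two matching
neighbours it prefers, one obtains `∑ load M + ∑ load M' ≤ 2 * ∑ load M * load M'`. As loads are in
`[0, 1]`, each agent has load `0` in both matchings or load `1` in both
(`PrefGraph.IsOSM.load_zero_or_one`). So the set of matched agents is the same for all ordinally
stable matchings, among them the matchings of stable partitions
(`PrefGraph.IsStablePartition.isOSM`), which leave exactly the singletons unmatched.

Stable partitions exist by induction on the edge set (`PrefGraph.exists_stablePartitionOn`). If `u`
is the first choice of `v`, then edges from `u` to agents it likes less than `v` can be deleted: a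
stable partition of the remaining graph is stable for the whole graph. If there are no such edges,
first choices form a permutation `π` whose inverse gives the last choices, and `π` is a stable
partition unless some agent has three choices. In that case the map from an agent to the
predecessor of its second choice leads from that agent to a cycle, and the first choices of the
agents on this cycle can be deleted simultaneously (`PrefGraph.IsReduced.exists_lt`). The one
obstruction, that a deletion takes away somebody's second choice too, would confine the agents on
the cycle, and with them the starting agent, to two choices each.

For the decision problem no stable partition has to be computed. In deferred acceptance, with all
agents proposing and receiving proposals, an agent `x` that holds the proposal of `y` satisfies
`M(x, ⪰ y) = 1` in every ordinally stable matching `M`, and a rejected pair has weight `0`. At the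
end each agent is held by somebody or rejected by all, and so the holders are exactly the fully
matched agents of `M` (`DeferredAcceptance.Inv.card_eq`). It remains to obtain sorted preference
lists in quadratic time. The rational satisfactions are scaled and rounded to integer keys of size
polynomial in `n`, without affecting their order (`WordRAM.keysRepresent`), and all `n ^ 2` pairs
are sorted by radix sort with base `n`, in `O(c + 1)` passes.

The program is written in a small structured language with variables and arrays, which is compiled
to the word RAM. `WordRAM.Runs` is total correctness with a time bound for compiled programs.
-/

/-! ### Loads of ordinally stable matchings -/

namespace PrefGraph

variable {V : Type u} {I : PrefGraph V}

theorem Strict.eq_of_sat_eq (hI : I.Strict) {v x y : V} (hx : I.G.Adj v x) (hy : I.G.Adj v y)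
    (h : I.sat v x = I.sat v y) : x = y := by
  by_contra hne
  exact hI v x y hx hy hne h

variable [Fintype V]

theorem IsMatching.load_eq {M : V → V → ℝ} (hM : I.IsMatching M) (v : V) :
    I.load M v = ∑ u, M v u := by
  classical
  unfold load
  rw [Finset.sum_filter]
  refine Finset.sum_congr rfl fun u _ => ?_
  split_ifs with h
  · rfl
  · exact (hM.support v u h).symm

open Classical in
theorem IsMatching.loadGe_eq {M : V → V → ℝ} (hM : I.IsMatching M) (x y : V) :
    I.loadGe M x y = ∑ z, if I.sat x y ≤ I.sat x z then M x z else 0 := by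
  unfold loadGe
  rw [Finset.sum_filter]
  refine Finset.sum_congr rfl fun z _ => ?_
  by_cases h : I.G.Adj x z
  · simp [h]
  · simp [h, hM.support x z h]

theorem IsMatching.load_nonneg {M : V → V → ℝ} (hM : I.IsMatching M) (v : V) :
    0 ≤ I.load M v := by
  rw [hM.load_eq]
  exact Finset.sum_nonneg fun u _ => hM.nonneg v u

theorem IsMatching.loadGe_le_load {M : V → V → ℝ} (hM : I.IsMatching M) (x y : V) :
    I.loadGe M x y ≤ I.load M x := by
  classical
  rw [hM.loadGe_eq, hM.load_eq]
  refine Finset.sum_le_sum fun z _ => ?_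
  split_ifs
  · exact le_rfl
  · exact hM.nonneg x z

theorem IsMatching.loadGe_le_one {M : V → V → ℝ} (hM : I.IsMatching M) (x y : V) :
    I.loadGe M x y ≤ 1 :=
  (hM.loadGe_le_load x y).trans (hM.load_le x)

theorem IsMatching.le_loadGe {M : V → V → ℝ} (hM : I.IsMatching M) (x y : V) :
    M x y ≤ I.loadGe M x y := by
  classical
  rw [hM.loadGe_eq]
  have := Finset.single_le_sum
    (f := fun z => if I.sat x y ≤ I.sat x z then M x z else 0) (s := Finset.univ)
    (fun z _ => by
      split_ifs
      · exact hM.nonneg x z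
      · exact le_rfl) (Finset.mem_univ y)
  simpa using this

/-- An agent that is saturated by the neighbours it weakly prefers to `y` has no weight on a
strictly less preferred one. -/
theorem IsMatching.eq_zero_of_sat_lt {M : V → V → ℝ} (hM : I.IsMatching M) {x y z : V}
    (h1 : I.loadGe M x y = 1) (hz : I.sat x z < I.sat x y) : M x z = 0 := by
  classical
  have hle : I.loadGe M x y + M x z ≤ I.load M x := by
    rw [hM.loadGe_eq, hM.load_eq, ← Finset.sum_erase_add _ _ (Finset.mem_univ z),
      ← Finset.sum_erase_add (Finset.univ) (fun u => M x u) (Finset.mem_univ z),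
      if_neg (not_le.mpr hz), add_zero]
    gcongr with u _
    split_ifs
    · exact le_rfl
    · exact hM.nonneg x u
  have := hM.load_le x
  have := hM.nonneg x z
  linarith

/-- If `y` has no weight on the neighbours it strictly prefers to its neighbour `x`, then `x` is
saturated by the neighbours it weakly prefers to `y`: otherwise stability forces weight `1` on
`{x, y}`. -/
theorem IsOSM.loadGe_eq_one_of_forall_better (hI : I.Strict) {M : V → V → ℝ} (hM : I.IsOSM M)
    {x y : V} (hadj : I.G.Adj y x)
    (hz : ∀ z, I.G.Adj y z → I.sat y x < I.sat y z → M y z = 0) : I.loadGe M x y = 1 := by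
  classical
  refine le_antisymm (hM.1.loadGe_le_one x y) (not_lt.mp fun hlt => ?_)
  have hyx : I.loadGe M y x = M y x := by
    rw [hM.1.loadGe_eq, Finset.sum_eq_single x]
    · simp
    · intro z _ hzx
      split_ifs with hle
      · by_cases ha : I.G.Adj y z
        · exact hz z ha (lt_of_le_of_ne hle (hI y x z hadj ha hzx.symm))
        · exact hM.1.support y z ha
      · rfl
    · simp
  have h2 : ¬ I.loadGe M y x < 1 := fun h => hM.2 y x ⟨hadj, h, hlt⟩
  have h3 := hM.1.le_loadGe x y
  rw [hM.1.symm x y] at h3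
  linarith

theorem IsOSM.loadGe_eq_one_of_mostPreferred (hI : I.Strict) {M : V → V → ℝ} (hM : I.IsOSM M)
    {x y : V} (h : I.MostPreferred y x) : I.loadGe M x y = 1 :=
  hM.loadGe_eq_one_of_forall_better hI h.1 fun z hz hlt => absurd (h.2 z hz) (not_le.mpr hlt)

/-- Counting the pairs of neighbours of `u` by which of the two is preferred: a pair counts twice
exactly if its components agree. -/
theorem sum_mul_loadGe_add (hI : I.Strict) {M M' : V → V → ℝ} (hM : I.IsMatching M)
    (hM' : I.IsMatching M') (u : V) :
    ∑ v, (M u v * I.loadGe M' u v + M' u v * I.loadGe M u v) =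
      I.load M u * I.load M' u + ∑ v, M u v * M' u v := by
  classical
  have h1 : ∑ v, M' u v * I.loadGe M u v =
      ∑ v, ∑ w, if I.sat u w ≤ I.sat u v then M u v * M' u w else 0 := by
    rw [Finset.sum_comm]
    refine Finset.sum_congr rfl fun v _ => ?_
    rw [hM.loadGe_eq, Finset.mul_sum]
    refine Finset.sum_congr rfl fun w _ => ?_
    split_ifs <;> ring
  have h2 : ∑ v, M u v * I.loadGe M' u v =
      ∑ v, ∑ w, if I.sat u v ≤ I.sat u w then M u v * M' u w else 0 := by
    refine Finset.sum_congr rfl fun v _ => ?_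
    rw [hM'.loadGe_eq, Finset.mul_sum]
    refine Finset.sum_congr rfl fun w _ => ?_
    split_ifs <;> ring
  have h3 : ∑ v, M u v * M' u v = ∑ v, ∑ w, if v = w then M u v * M' u w else 0 := by
    simp only [Finset.sum_ite_eq, Finset.mem_univ, if_true]
  rw [Finset.sum_add_distrib, h1, h2, h3, hM.load_eq, hM'.load_eq, Finset.sum_mul_sum,
    ← Finset.sum_add_distrib, ← Finset.sum_add_distrib]
  refine Finset.sum_congr rfl fun v _ => ?_
  rw [← Finset.sum_add_distrib, ← Finset.sum_add_distrib]
  refine Finset.sum_congr rfl fun w _ => ?_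
  by_cases hv : I.G.Adj u v
  · by_cases hw : I.G.Adj u w
    · by_cases hvw : v = w
      · subst hvw
        simp
      · rcases lt_or_gt_of_ne (hI u v w hv hw hvw) with h | h
        · rw [if_pos h.le, if_neg (not_le.mpr h), if_neg hvw]
        · rw [if_neg (not_le.mpr h), if_pos h.le, if_neg hvw]
          ring
    · simp [hM'.support u w hw]
  · simp [hM.support u v hv]

/-- Stability of `M'`, weighted with `M`: at every edge one end is saturated above it by `M'`. -/
theorem two_mul_sum_mul_loadGe {M M' : V → V → ℝ} (hM : I.IsMatching M) (hM' : I.IsOSM M') :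
    ∑ u, I.load M u + ∑ u, ∑ v, M u v * M' u v ≤ 2 * ∑ u, ∑ v, M u v * I.loadGe M' u v := by
  have hswap : ∑ u, ∑ v, M u v * I.loadGe M' u v = ∑ u, ∑ v, M u v * I.loadGe M' v u := by
    rw [Finset.sum_comm]
    refine Finset.sum_congr rfl fun u _ => Finset.sum_congr rfl fun v _ => ?_
    rw [hM.symm v u]
  rw [two_mul]
  nth_rw 2 [hswap]
  simp only [hM.load_eq]
  rw [← Finset.sum_add_distrib, ← Finset.sum_add_distrib]
  refine Finset.sum_le_sum fun u _ => ?_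
  rw [← Finset.sum_add_distrib, ← Finset.sum_add_distrib]
  refine Finset.sum_le_sum fun v _ => ?_
  by_cases hv : I.G.Adj u v
  · -- one end of the edge is saturated above it, the other one still sees the edge itself
    have hsum : 1 + M' u v ≤ I.loadGe M' u v + I.loadGe M' v u := by
      have h1 := hM'.1.le_loadGe u v
      have h2 := hM'.1.le_loadGe v u
      rw [hM'.1.symm v u] at h2
      by_cases h : I.loadGe M' u v < 1
      · have : ¬ I.loadGe M' v u < 1 := fun h' => hM'.2 u v ⟨hv, h, h'⟩
        linarith
      · linarith
    have := mul_le_mul_of_nonneg_left hsum (hM.nonneg u v)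
    linarith
  · simp [hM.support u v hv]

/-- Two ordinally stable matchings give every agent the same load. With `M = M'` this shows that
the loads are `0` or `1`. -/
theorem IsOSM.load_zero_or_one (hI : I.Strict) {M M' : V → V → ℝ} (hM : I.IsOSM M)
    (hM' : I.IsOSM M') (v : V) :
    (I.load M v = 0 ∧ I.load M' v = 0) ∨ (I.load M v = 1 ∧ I.load M' v = 1) := by
  have h1 := two_mul_sum_mul_loadGe hM.1 hM'
  have h2 := two_mul_sum_mul_loadGe hM'.1 hM
  have h3 : ∑ u, ∑ v, (M u v * I.loadGe M' u v + M' u v * I.loadGe M u v) =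
      ∑ u, (I.load M u * I.load M' u + ∑ v, M u v * M' u v) :=
    Finset.sum_congr rfl fun u _ => sum_mul_loadGe_add hI hM.1 hM'.1 u
  simp only [Finset.sum_add_distrib] at h3
  have h4 : ∑ u, ∑ v, M' u v * M u v = ∑ u, ∑ v, M u v * M' u v :=
    Finset.sum_congr rfl fun u _ => Finset.sum_congr rfl fun v _ => mul_comm _ _
  have hnn : ∀ u ∈ Finset.univ,
      0 ≤ I.load M u * (1 - I.load M' u) + I.load M' u * (1 - I.load M u) := fun u _ =>
    add_nonneg (mul_nonneg (hM.1.load_nonneg u) (sub_nonneg.mpr (hM'.1.load_le u)))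
      (mul_nonneg (hM'.1.load_nonneg u) (sub_nonneg.mpr (hM.1.load_le u)))
  have hsum : ∑ u, (I.load M u * (1 - I.load M' u) + I.load M' u * (1 - I.load M u)) =
      ∑ u, I.load M u + ∑ u, I.load M' u - 2 * ∑ u, I.load M u * I.load M' u := by
    rw [Finset.mul_sum, ← Finset.sum_add_distrib, ← Finset.sum_sub_distrib]
    exact Finset.sum_congr rfl fun u _ => by ring
  have hzero := (Finset.sum_eq_zero_iff_of_nonneg hnn).mp
    (le_antisymm (by linarith) (Finset.sum_nonneg hnn)) v (Finset.mem_univ v)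
  have ha := hM.1.load_nonneg v
  have ha' := hM.1.load_le v
  have hb := hM'.1.load_nonneg v
  have hb' := hM'.1.load_le v
  have hp : I.load M v * (1 - I.load M' v) = 0 := by
    have := mul_nonneg ha (sub_nonneg.mpr hb')
    have := mul_nonneg hb (sub_nonneg.mpr ha')
    linarith
  rcases mul_eq_zero.mp hp with h | h
  · left
    rw [h] at hzero
    exact ⟨h, by linarith⟩
  · right
    have h' : I.load M' v = 1 := by linarith
    rw [h'] at hzero
    exact ⟨by linarith, h'⟩

theorem IsOSM.matched_iff_fullyMatched (hI : I.Strict) {M M' : V → V → ℝ} (hM : I.IsOSM M)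
    (hM' : I.IsOSM M') (v : V) : I.Matched M v ↔ I.FullyMatched M' v := by
  unfold Matched FullyMatched
  rcases hM.load_zero_or_one hI hM' v with ⟨h, h'⟩ | ⟨h, h'⟩ <;> simp [h, h']

theorem IsOSM.numFully_eq (hI : I.Strict) {M M' : V → V → ℝ} (hM : I.IsOSM M)
    (hM' : I.IsOSM M') : I.numFully M = I.numFully M' := by
  unfold numFully
  congr 1
  ext v
  exact (hM.matched_iff_fullyMatched hI hM v).symm.trans (hM.matched_iff_fullyMatched hI hM' v)

end PrefGraph

/-! ### The matching of a stable partition -/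

namespace PrefGraph

variable {V : Type u} {I : PrefGraph V}

theorem IsStablePartition.adj_symm {π : Equiv.Perm V} (hπ : I.IsStablePartition π) {v : V}
    (h : π v ≠ v) : I.G.Adj v (π.symm v) := by
  have h' : π (π.symm v) ≠ π.symm v := by
    rw [Equiv.apply_symm_apply]
    intro h0
    exact h (by rw [Equiv.eq_symm_apply] at h0; exact h0)
  have := hπ.adj _ h'
  rw [Equiv.apply_symm_apply] at this
  exact this.symm

/-- `stable` does not let a singleton `w` be preferred by a neighbour, not even if `w` has
satisfaction `0` towards it: apply the condition to `w` itself. -/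
theorem IsStablePartition.ne_of_prefers {π : Equiv.Perm V} (hπ : I.IsStablePartition π) {v w : V}
    (hvw : I.G.Adj v w) (h : π v = v ∨ I.sat v (π.symm v) < I.sat v w) : π w ≠ w := by
  intro hw
  have hw' : π.symm w = w := by rw [Equiv.symm_apply_eq, hw]
  have h1 := hπ.stable w v hvw.symm (Or.inl hw)
  rcases h with h | h
  · have hv' : π.symm v = v := by rw [Equiv.symm_apply_eq, h]
    have h2 := hπ.stable v w hvw (Or.inl h)
    rw [hw', I.sat_self] at h2
    rw [hv', I.sat_self] at h1
    rcases (I.adj_iff v w).mp hvw with h3 | h3 <;> linarith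
  · linarith

end PrefGraph

open Classical in
theorem partitionMatching_of_ne {V : Type u} {π : Equiv.Perm V} {v : V} (h : π v ≠ v) (w : V) :
    partitionMatching π v w =
      (if w = π v then 1 / 2 else 0) + (if w = π.symm v then 1 / 2 else 0) := by
  unfold partitionMatching
  have hsym : w = π.symm v ↔ π w = v := Equiv.eq_symm_apply π
  have h1 : w = π v ↔ π v = w := eq_comm
  rw [if_congr h1 rfl rfl, if_congr hsym rfl rfl]
  by_cases hvw : v = w
  · subst hvw
    simp [h]
  · by_cases h2 : π v = w
    · by_cases h3 : π w = v
      · rw [if_neg hvw, if_pos ⟨h2, h3⟩, if_pos h2, if_pos h3]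
        norm_num
      · simp [hvw, h2, h3]
    · by_cases h3 : π w = v
      · simp [hvw, h2, h3]
      · simp [hvw, h2, h3]

theorem partitionMatching_of_eq {V : Type u} {π : Equiv.Perm V} {v : V} (h : π v = v) (w : V) :
    partitionMatching π v w = 0 := by
  unfold partitionMatching
  by_cases hvw : v = w
  · simp [hvw]
  · have h2 : π w ≠ v := fun h' => hvw (π.injective (h.trans h'.symm))
    simp [h, hvw, h2]

theorem partitionMatching_symm {V : Type u} (π : Equiv.Perm V) (v w : V) :
    partitionMatching π v w = partitionMatching π w v := by
  unfold partitionMatching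
  by_cases hvw : v = w
  · simp [hvw]
  · have hwv : w ≠ v := fun h => hvw h.symm
    by_cases h1 : π v = w <;> by_cases h2 : π w = v <;> simp [hvw, hwv, h1, h2]

namespace PrefGraph

variable {V : Type u} {I : PrefGraph V} [Fintype V]

theorem IsStablePartition.isMatching {π : Equiv.Perm V} (hπ : I.IsStablePartition π) :
    I.IsMatching (partitionMatching π) where
  symm := partitionMatching_symm π
  nonneg u v := by
    unfold partitionMatching
    split_ifs <;> norm_num
  support u v h := by
    by_cases hu : π u = u
    · exact partitionMatching_of_eq hu v
    · rw [partitionMatching_of_ne hu, if_neg, if_neg]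
      · norm_num
      · rintro rfl
        exact h (hπ.adj_symm hu)
      · rintro rfl
        exact h (hπ.adj u hu)
  load_le v := by
    classical
    unfold load
    by_cases hv : π v = v
    · simp [partitionMatching_of_eq hv]
    · simp only [partitionMatching_of_ne hv, Finset.sum_add_distrib, Finset.sum_ite_eq']
      split_ifs <;> norm_num

theorem IsStablePartition.matched_iff {π : Equiv.Perm V} (hπ : I.IsStablePartition π) (v : V) :
    I.Matched (partitionMatching π) v ↔ π v ≠ v := by
  classical
  unfold Matched
  rw [hπ.isMatching.load_eq]
  by_cases hv : π v = v
  · simp [partitionMatching_of_eq hv, hv]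
  · simp [partitionMatching_of_ne hv, Finset.sum_add_distrib, hv]

theorem IsStablePartition.loadGe_eq_one {π : Equiv.Perm V} (hπ : I.IsStablePartition π) {v w : V}
    (hv : π v ≠ v) (hw : I.sat v w ≤ I.sat v (π.symm v)) :
    I.loadGe (partitionMatching π) v w = 1 := by
  classical
  have hw' : I.sat v w ≤ I.sat v (π v) := by
    by_cases h : π v = π.symm v
    · rwa [h]
    · exact hw.trans (hπ.cycle v h).le
  have hterm : ∀ z, (if I.sat v w ≤ I.sat v z then partitionMatching π v z else 0) =
      (if z = π v then 1 / 2 else 0) + (if z = π.symm v then 1 / 2 else 0) := by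
    intro z
    rw [partitionMatching_of_ne hv]
    split_ifs with h h1 h2 h2 h1 h2 h2 <;> simp_all
  rw [hπ.isMatching.loadGe_eq, Finset.sum_congr rfl fun z _ => hterm z, Finset.sum_add_distrib]
  norm_num

theorem IsStablePartition.isOSM {π : Equiv.Perm V} (hπ : I.IsStablePartition π) :
    I.IsOSM (partitionMatching π) := by
  refine ⟨hπ.isMatching, fun u v h => ?_⟩
  obtain ⟨hadj, h1, h2⟩ := h
  by_cases h : π u = u ∨ I.sat u (π.symm u) < I.sat u v
  · exact h2.ne (hπ.loadGe_eq_one (hπ.ne_of_prefers hadj h) (hπ.stable u v hadj h))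
  · rw [not_or, not_lt] at h
    exact h1.ne (hπ.loadGe_eq_one h.1 h.2)

end PrefGraph

/-! ### Existence of stable partitions -/

namespace PrefGraph

variable {V : Type u} {I : PrefGraph V}

/-- `π` is a stable partition of the subgraph `H` of the acceptability graph. In contrast to
`IsStablePartition`, the last field says explicitly that the agent `w` is not a singleton, so that
agents that are isolated in `H` need no special treatment. -/
structure StablePartitionOn (I : PrefGraph V) (H : SimpleGraph V) (π : Equiv.Perm V) : Prop where
  adj : ∀ v, π v ≠ v → H.Adj v (π v)
  cycle : ∀ v, π v ≠ π.symm v → I.sat v (π.symm v) < I.sat v (π v)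
  stable : ∀ v w, H.Adj v w → (π v = v ∨ I.sat v (π.symm v) < I.sat v w) →
    π w ≠ w ∧ I.sat w v ≤ I.sat w (π.symm w)

theorem StablePartitionOn.isStablePartition {π : Equiv.Perm V}
    (hπ : I.StablePartitionOn I.G π) : I.IsStablePartition π :=
  ⟨hπ.adj, hπ.cycle, fun v w h h' => (hπ.stable v w h h').2⟩

/-- `u` is the first choice of `v` among its neighbours in `H`. -/
def FirstIn (I : PrefGraph V) (H : SimpleGraph V) (v u : V) : Prop :=
  H.Adj v u ∧ ∀ w, H.Adj v w → I.sat v w ≤ I.sat v u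

theorem ne_symm_apply {π : Equiv.Perm V} {v : V} (h : π v ≠ v) : π.symm v ≠ v := by
  intro h'
  rw [Equiv.symm_apply_eq] at h'
  exact h h'.symm

/-- In a stable partition, the first choice `u` of `v` is not a singleton and its predecessor is at
least as good as `v`. -/
theorem StablePartitionOn.first (hI : I.Strict) {H : SimpleGraph V} (hH : H ≤ I.G)
    {π : Equiv.Perm V} (hπ : I.StablePartitionOn H π) {v u : V} (h : I.FirstIn H v u) :
    π u ≠ u ∧ I.sat u v ≤ I.sat u (π.symm u) := by
  by_cases hc : π v = v ∨ I.sat v (π.symm v) < I.sat v u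
  · exact hπ.stable v u h.1 hc
  · rw [not_or, not_lt] at hc
    have hadj : H.Adj v (π.symm v) := by
      have := hπ.adj (π.symm v) (by
        rw [Equiv.apply_symm_apply]
        exact (ne_symm_apply hc.1).symm)
      rw [Equiv.apply_symm_apply] at this
      exact this.symm
    have h1 : π.symm v = u :=
      hI.eq_of_sat_eq (hH hadj) (hH h.1) (le_antisymm (h.2 _ hadj) hc.2)
    have h2 : π v = π.symm v := by
      by_contra hne
      have h3 := hπ.cycle v hne
      have h4 := h.2 _ (hπ.adj v hc.1)
      rw [h1] at h3
      exact absurd h3 (not_lt.mpr h4)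
    have h3 : π.symm u = v := by rw [Equiv.symm_apply_eq, h2, h1]
    have h4 : π u = v := by rw [← h1, Equiv.apply_symm_apply]
    refine ⟨?_, by rw [h3]⟩
    rw [h4]
    exact h.1.ne

/-- Deleting edges `{u, z}` such that `u` likes `z` less than an agent with first choice `u` does
not create new stable partitions. -/
theorem StablePartitionOn.mono (hI : I.Strict) {H' H : SimpleGraph V} (hle : H' ≤ H)
    (hH : H ≤ I.G)
    (hdel : ∀ a b, H.Adj a b → ¬ H'.Adj a b →
      (∃ v, I.FirstIn H' v a ∧ I.sat a b < I.sat a v) ∨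
      (∃ v, I.FirstIn H' v b ∧ I.sat b a < I.sat b v))
    {π : Equiv.Perm V} (hπ : I.StablePartitionOn H' π) : I.StablePartitionOn H π where
  adj v h := hle (hπ.adj v h)
  cycle := hπ.cycle
  stable v w hvw h := by
    by_cases hadj : H'.Adj v w
    · exact hπ.stable v w hadj h
    · rcases hdel v w hvw hadj with ⟨x, hx, hlt⟩ | ⟨x, hx, hlt⟩
      · obtain ⟨h1, h2⟩ := hπ.first hI (hle.trans hH) hx
        rcases h with h | h
        · exact absurd h h1
        · linarith
      · obtain ⟨h1, h2⟩ := hπ.first hI (hle.trans hH) hx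
        exact ⟨h1, by linarith⟩

/-- The table `H` at the end of the proposal phase: `π` maps every agent that is not isolated in `H`
to its first choice, `π.symm` maps it to its last choice, and isolated agents are fixed. -/
structure IsReduced (I : PrefGraph V) (H : SimpleGraph V) (π : Equiv.Perm V) : Prop where
  adj : ∀ v w, H.Adj v w → H.Adj v (π v) ∧ H.Adj v (π.symm v)
  fixed : ∀ v, π v ≠ v → H.Adj v (π v)
  le_first : ∀ v w, H.Adj v w → I.sat v w ≤ I.sat v (π v)
  last_le : ∀ v w, H.Adj v w → I.sat v (π.symm v) ≤ I.sat v w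

/-- If every first choice `u` of an agent `v` has `v` as its last choice, then first choices are
distinct, and so they form a permutation. -/
theorem exists_isReduced [Finite V] (hI : I.Strict) {H : SimpleGraph V} (hH : H ≤ I.G)
    (hlast : ∀ v u z, I.FirstIn H v u → H.Adj u z → I.sat u v ≤ I.sat u z) :
    ∃ π : Equiv.Perm V, I.IsReduced H π := by
  have hex : ∀ v, ∃ u, (∀ w, H.Adj v w → I.FirstIn H v u) ∧ ((∀ w, ¬ H.Adj v w) → u = v) := by
    intro v
    by_cases h : ∃ w, H.Adj v w
    · obtain ⟨u, hu, hmax⟩ := Set.exists_max_image {w | H.Adj v w} (I.sat v) (Set.toFinite _) h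
      obtain ⟨w, hw⟩ := h
      exact ⟨u, fun _ _ => ⟨hu, hmax⟩, fun h => absurd hw (h w)⟩
    · rw [not_exists] at h
      exact ⟨v, fun w hw => absurd hw (h w), fun _ => rfl⟩
  choose f hf hf' using hex
  have hinj : Function.Injective f := by
    intro v v' h
    by_cases hv : ∃ w, H.Adj v w
    · obtain ⟨w, hw⟩ := hv
      have h1 := hf v w hw
      have hv' : ∃ w, H.Adj v' w := by
        by_contra hno
        rw [not_exists] at hno
        rw [h, hf' v' hno] at h1
        exact hno v h1.1.symm
      obtain ⟨w', hw'⟩ := hv'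
      have h2 := hf v' w' hw'
      rw [← h] at h2
      exact hI.eq_of_sat_eq (hH h1.1.symm) (hH h2.1.symm)
        (le_antisymm (hlast _ _ _ h1 h2.1.symm) (hlast _ _ _ h2 h1.1.symm))
    · rw [not_exists] at hv
      rw [hf' v hv] at h
      by_cases hv' : ∃ w, H.Adj v' w
      · obtain ⟨w', hw'⟩ := hv'
        have h2 := (hf v' w' hw').1
        rw [← h] at h2
        exact absurd h2.symm (hv v')
      · rw [not_exists] at hv'
        rw [h, hf' v' hv']
  let π : Equiv.Perm V := Equiv.ofBijective f (Finite.injective_iff_bijective.mp hinj)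
  have hsymm : ∀ v w, H.Adj v w → I.FirstIn H (π.symm v) v := by
    intro v w hw
    have h1 : f (π.symm v) = v := Equiv.ofBijective_apply_symm_apply f _ v
    have h2 : ∃ u, H.Adj (π.symm v) u := by
      by_contra hno
      rw [not_exists] at hno
      have h3 := hf' _ hno
      rw [h1] at h3
      rw [← h3] at hno
      exact hno w hw
    obtain ⟨u, hu⟩ := h2
    have := hf _ u hu
    rwa [h1] at this
  refine ⟨π, fun v w hw => ⟨(hf v w hw).1, (hsymm v w hw).1.symm⟩, fun v hv => ?_,
    fun v w hw => (hf v w hw).2 w hw, fun v w hw => hlast _ _ _ (hsymm v w hw) hw⟩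
  by_cases h : ∃ w, H.Adj v w
  · obtain ⟨w, hw⟩ := h
    exact (hf v w hw).1
  · rw [not_exists] at h
    exact absurd (hf' v h) hv

/-- A reduced table with at most two choices for every agent is a stable partition. -/
theorem IsReduced.stablePartitionOn (hI : I.Strict) {H : SimpleGraph V} (hH : H ≤ I.G)
    {π : Equiv.Perm V} (hπ : I.IsReduced H π)
    (hdeg : ∀ v w, H.Adj v w → w = π v ∨ w = π.symm v) : I.StablePartitionOn H π where
  adj := hπ.fixed
  cycle v hv := by
    by_cases h : π v = v
    · exact absurd (by rw [Equiv.eq_symm_apply, h, h]) hv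
    · have h1 := hπ.adj v _ (hπ.fixed v h)
      exact lt_of_le_of_ne (hπ.last_le v _ h1.1) (hI v _ _ (hH h1.2) (hH h1.1) (Ne.symm hv))
  stable v w hvw h := by
    have hne : w ≠ π.symm v := by
      rintro rfl
      rcases h with h | h
      · exact hvw.ne (by rw [Equiv.eq_symm_apply, h])
      · exact lt_irrefl _ h
    have hw : w = π v := (hdeg v w hvw).resolve_right hne
    have hw' : π.symm w = v := by rw [hw, Equiv.symm_apply_apply]
    refine ⟨fun h' => ?_, by rw [hw']⟩
    rw [hw] at h'
    exact hvw.ne (by rw [hw, π.injective h'])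

/-- The second choice of an agent. -/
theorem IsReduced.exists_second [Finite V] {H : SimpleGraph V} {π : Equiv.Perm V}
    (hπ : I.IsReduced H π) :
    ∃ s : V → V, ∀ v, π v ≠ π.symm v → H.Adj v (s v) ∧ s v ≠ π v ∧
      ∀ w, H.Adj v w → w ≠ π v → I.sat v w ≤ I.sat v (s v) := by
  have : ∀ v, ∃ s, π v ≠ π.symm v → H.Adj v s ∧ s ≠ π v ∧
      ∀ w, H.Adj v w → w ≠ π v → I.sat v w ≤ I.sat v s := by
    intro v
    by_cases hv : π v = π.symm v
    · exact ⟨v, fun h => absurd hv h⟩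
    · have h0 : π v ≠ v := by
        intro h
        exact hv (by rw [Equiv.eq_symm_apply, h, h])
      have h1 := (hπ.adj v _ (hπ.fixed v h0)).2
      obtain ⟨s, hs, hmax⟩ := Set.exists_max_image {w | H.Adj v w ∧ w ≠ π v} (I.sat v)
        (Set.toFinite _) ⟨π.symm v, h1, Ne.symm hv⟩
      exact ⟨s, fun _ => ⟨hs.1, hs.2, fun w hw hw' => hmax w ⟨hw, hw'⟩⟩⟩
  choose s hs using this
  exact ⟨s, hs⟩

/-- The step from an agent `v` along a rotation: the agent that has the second choice `s v` of `v`
as its first choice. -/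
def rotationStep (π : Equiv.Perm V) (s : V → V) (v : V) : V := π.symm (s v)

/-- If `s v` is the second choice of every agent `v` with two choices, then the rotation step leads
to an agent with two choices again. -/
theorem IsReduced.rotationStep_ne (hI : I.Strict) {H : SimpleGraph V} (hH : H ≤ I.G)
    {π : Equiv.Perm V} (hπ : I.IsReduced H π) {s : V → V} {v : V}
    (hs : H.Adj v (s v) ∧ s v ≠ π v) :
    π (rotationStep π s v) ≠ π.symm (rotationStep π s v) := by
  unfold rotationStep
  rw [Equiv.apply_symm_apply, Ne, Equiv.eq_symm_apply]
  intro h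
  -- then `s v` has a single choice, which must be `v`
  have h1 := hπ.le_first _ _ hs.1.symm
  have h2 := hπ.last_le _ _ hs.1.symm
  rw [← h] at h2
  have h3 := hI.eq_of_sat_eq (hH hs.1.symm) (hH (hπ.adj _ _ hs.1.symm).1) (le_antisymm h1 h2)
  rw [Equiv.eq_symm_apply, ← h3] at h
  exact hs.2 h.symm

/-- A closed rotation `X` is degenerate if the second choice of some agent of `X` is again in `X`
and has this agent as its first choice. Then all agents on the cycle of `π` through that agent
are of this kind, and have no choices but the neighbours on that cycle. -/
theorem IsReduced.degenerate_closed [Finite V] (hI : I.Strict) {H : SimpleGraph V} (hH : H ≤ I.G)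
    {π : Equiv.Perm V} (hπ : I.IsReduced H π) {s : V → V}
    (hs : ∀ v, π v ≠ π.symm v → H.Adj v (s v) ∧ s v ≠ π v ∧
      ∀ w, H.Adj v w → w ≠ π v → I.sat v w ≤ I.sat v (s v))
    {X : Set V} (hX : ∀ v ∈ X, π v ≠ π.symm v)
    (hsurj : ∀ v ∈ X, ∃ w ∈ X, rotationStep π s w = v) {v w : V} (hvw : H.Adj v w)
    (hv : v ∈ X ∧ s v ∈ X ∧ π (s v) = v) :
    (w = π v ∨ w = π.symm v) ∧ (w ∈ X ∧ s w ∈ X ∧ π (s w) = w) := by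
  have hnbr : ∀ x, (x ∈ X ∧ s x ∈ X ∧ π (s x) = x) → ∀ y, H.Adj x y → y = π x ∨ y = π.symm x := by
    rintro x ⟨h1, -, h3⟩ y hy
    by_cases hyx : y = π x
    · exact Or.inl hyx
    · right
      obtain ⟨h4, -, h6⟩ := hs x (hX x h1)
      have h7 : s x = π.symm x := by rw [Equiv.eq_symm_apply, h3]
      have h8 := hπ.last_le x y hy
      have h9 := h6 y hy hyx
      rw [h7] at h4 h9
      exact hI.eq_of_sat_eq (hH hy) (hH h4) (le_antisymm h9 h8)
  have hstep : ∀ x, (x ∈ X ∧ s x ∈ X ∧ π (s x) = x) →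
      (π x ∈ X ∧ s (π x) ∈ X ∧ π (s (π x)) = π x) := by
    rintro x ⟨h1, h2, h3⟩
    obtain ⟨b, hbX, hb⟩ := hsurj (s x) h2
    unfold rotationStep at hb
    rw [Equiv.symm_apply_eq, h3] at hb
    have hbs := hs b (hX b hbX)
    rw [hb] at hbs
    have hbx : b = π x := by
      refine (hnbr x ⟨h1, h2, h3⟩ b hbs.1.symm).resolve_right fun h => ?_
      rw [Equiv.eq_symm_apply] at h
      exact hbs.2.1 h.symm
    rw [← hbx, hb]
    exact ⟨hbX, h1, hbx.symm⟩
  have hpow : ∀ k : ℕ, ((π ^ k) v ∈ X ∧ s ((π ^ k) v) ∈ X ∧ π (s ((π ^ k) v)) = (π ^ k) v) := by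
    intro k
    induction k with
    | zero => exact hv
    | succ k ih =>
      rw [pow_succ', Equiv.Perm.mul_apply]
      exact hstep _ ih
  have hinv : π.symm v = (π ^ (orderOf π - 1)) v := by
    rw [Equiv.symm_apply_eq, ← Equiv.Perm.mul_apply, ← pow_succ',
      Nat.sub_add_cancel (orderOf_pos π), pow_orderOf_eq_one, Equiv.Perm.one_apply]
  refine ⟨hnbr v hv w hvw, ?_⟩
  rcases hnbr v hv w hvw with rfl | rfl
  · exact hstep v hv
  · rw [hinv]
    exact hpow _

/-- Eliminating a rotation: if some agent of a reduced table has three choices, then edges can be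
deleted as in `StablePartitionOn.mono`. -/
theorem IsReduced.exists_lt [Finite V] (hI : I.Strict) {H : SimpleGraph V} (hH : H ≤ I.G)
    {π : Equiv.Perm V} (hπ : I.IsReduced H π) {v₀ w₀ : V} (h₀ : H.Adj v₀ w₀) (h₁ : w₀ ≠ π v₀)
    (h₂ : w₀ ≠ π.symm v₀) :
    ∃ H' < H, ∀ a b, H.Adj a b → ¬ H'.Adj a b →
      (∃ v, I.FirstIn H' v a ∧ I.sat a b < I.sat a v) ∨
      (∃ v, I.FirstIn H' v b ∧ I.sat b a < I.sat b v) := by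
  obtain ⟨s, hs⟩ := hπ.exists_second
  have hv₀ : π v₀ ≠ π.symm v₀ := by
    intro h
    have h3 := hπ.last_le v₀ w₀ h₀
    rw [← h] at h3
    exact h₁ (hI.eq_of_sat_eq (hH h₀) (hH (hπ.adj _ _ h₀).1)
      (le_antisymm (hπ.le_first v₀ w₀ h₀) h3))
  let o : ℕ → V := fun m => (rotationStep π s)^[m] v₀
  have hosucc : ∀ m, o (m + 1) = rotationStep π s (o m) := fun m =>
    Function.iterate_succ_apply' _ _ _
  have ho : ∀ m, π (o m) ≠ π.symm (o m) := by
    intro m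
    induction m with
    | zero => exact hv₀
    | succ m ih =>
      rw [hosucc]
      have := hs _ ih
      exact hπ.rotationStep_ne hI hH ⟨this.1, this.2.1⟩
  obtain ⟨a, b, hab, hoab⟩ : ∃ a b, a < b ∧ o a = o b := by
    obtain ⟨a, b, hne, h⟩ := Finite.exists_ne_map_eq_of_infinite o
    rcases lt_or_gt_of_ne hne with hlt | hlt
    · exact ⟨a, b, hlt, h⟩
    · exact ⟨b, a, hlt, h.symm⟩
  -- the closed rotation that is reached from `v₀`
  let X : Set V := {v | ∃ m, a ≤ m ∧ o m = v}
  have hX : ∀ v ∈ X, π v ≠ π.symm v := by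
    rintro _ ⟨m, -, rfl⟩
    exact ho m
  have hsurj : ∀ v ∈ X, ∃ w ∈ X, rotationStep π s w = v := by
    rintro _ ⟨m, hm, rfl⟩
    rcases Nat.eq_or_lt_of_le hm with rfl | hlt
    · refine ⟨o (b - 1), ⟨b - 1, by omega, rfl⟩, ?_⟩
      rw [← hosucc, Nat.sub_add_cancel (by omega), hoab]
    · refine ⟨o (m - 1), ⟨m - 1, by omega, rfl⟩, ?_⟩
      rw [← hosucc, Nat.sub_add_cancel (by omega)]
  have hgood : ∀ v ∈ X, ¬ (s v ∈ X ∧ π (s v) = v) := by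
    rintro _ ⟨m, hm, rfl⟩ ⟨hsX, hsv⟩
    -- degeneracy would spread along the edges back to `v₀`, which has three choices
    have hback : ∀ j, (o j ∈ X ∧ s (o j) ∈ X ∧ π (s (o j)) = o j) →
        (v₀ ∈ X ∧ s v₀ ∈ X ∧ π (s v₀) = v₀) := by
      intro j
      induction j with
      | zero => exact id
      | succ j ih =>
        intro h
        have hso := (hs _ (ho j)).1
        have hadj : H.Adj (o (j + 1)) (s (o j)) := by
          rw [hosucc]
          exact (hπ.adj _ _ hso.symm).2.symm
        have h1 := (hπ.degenerate_closed hI hH hs hX hsurj hadj h).2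
        exact ih (hπ.degenerate_closed hI hH hs hX hsurj hso.symm h1).2
    have h := hback m ⟨⟨m, hm, rfl⟩, hsX, hsv⟩
    rcases (hπ.degenerate_closed hI hH hs hX hsurj h₀ h).1 with h3 | h3
    · exact h₁ h3
    · exact h₂ h3
  have hadjX : ∀ x ∈ X, H.Adj x (π x) := fun x hx => (hπ.adj _ _ (hs x (hX x hx)).1).1
  refine ⟨H.deleteEdges {e | ∃ x ∈ X, e = s(x, π x)}, ?_, ?_⟩
  · refine lt_of_le_of_ne (SimpleGraph.deleteEdges_le _) fun h => ?_
    have hoa : o a ∈ X := ⟨a, le_rfl, rfl⟩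
    have h1 := hadjX _ hoa
    rw [← h, SimpleGraph.deleteEdges_adj] at h1
    exact h1.2 ⟨_, hoa, rfl⟩
  · have key : ∀ x ∈ X, ∃ v, I.FirstIn (H.deleteEdges {e | ∃ x ∈ X, e = s(x, π x)}) v (π x) ∧
        I.sat (π x) x < I.sat (π x) v := by
      intro x hx
      obtain ⟨y, hy, hyx⟩ := hsurj x hx
      unfold rotationStep at hyx
      rw [Equiv.symm_apply_eq] at hyx
      obtain ⟨h1, h2, h3⟩ := hs y (hX y hy)
      have hne : x ≠ y := by
        rintro rfl
        exact h2 hyx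
      refine ⟨y, ⟨?_, fun w hw => ?_⟩, ?_⟩
      · rw [← hyx, SimpleGraph.deleteEdges_adj]
        refine ⟨h1, ?_⟩
        rintro ⟨x', hx', he⟩
        rcases Sym2.eq_iff.mp he with ⟨h4, h5⟩ | ⟨h4, h5⟩
        · rw [← h4] at h5
          exact h2 h5
        · exact hgood y hy ⟨h5 ▸ hx', by rw [h5, ← h4]⟩
      · rw [SimpleGraph.deleteEdges_adj] at hw
        rw [← hyx]
        exact h3 w hw.1 fun h => hw.2 ⟨y, hy, by rw [h]⟩
      · rw [hyx] at h1
        have h4 := hπ.last_le _ _ h1.symm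
        rw [Equiv.symm_apply_apply] at h4
        exact lt_of_le_of_ne h4 (hI _ _ _ (hH (hadjX x hx).symm) (hH h1.symm) hne)
    intro p q hpq hnot
    rw [SimpleGraph.deleteEdges_adj, not_and, not_not] at hnot
    obtain ⟨x, hx, he⟩ := hnot hpq
    rcases Sym2.eq_iff.mp he with ⟨rfl, rfl⟩ | ⟨rfl, rfl⟩
    · exact Or.inr (key _ hx)
    · exact Or.inl (key _ hx)

theorem exists_stablePartitionOn [Finite V] (hI : I.Strict) (H : SimpleGraph V) (hH : H ≤ I.G) :
    ∃ π : Equiv.Perm V, I.StablePartitionOn H π := by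
  induction H using WellFoundedLT.induction with
  | ind H ih =>
    by_cases hlast : ∀ v u z, I.FirstIn H v u → H.Adj u z → I.sat u v ≤ I.sat u z
    · obtain ⟨π, hπ⟩ := exists_isReduced hI hH hlast
      by_cases hdeg : ∀ v w, H.Adj v w → w = π v ∨ w = π.symm v
      · exact ⟨π, hπ.stablePartitionOn hI hH hdeg⟩
      · push Not at hdeg
        obtain ⟨v, w, h, h1, h2⟩ := hdeg
        obtain ⟨H', hlt, hdel⟩ := hπ.exists_lt hI hH h h1 h2
        obtain ⟨π', hπ'⟩ := ih H' hlt (hlt.le.trans hH)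
        exact ⟨π', hπ'.mono hI hlt.le hH hdel⟩
    · push Not at hlast
      obtain ⟨v, u, z, hvu, huz, hlt⟩ := hlast
      have hle : H.deleteEdges {s(u, z)} ≤ H := SimpleGraph.deleteEdges_le _
      have hne : H.deleteEdges {s(u, z)} ≠ H := by
        intro h
        rw [← h, SimpleGraph.deleteEdges_adj] at huz
        exact huz.2 rfl
      have hzv : v ≠ z := by
        rintro rfl
        exact lt_irrefl _ hlt
      have hfirst : I.FirstIn (H.deleteEdges {s(u, z)}) v u := by
        refine ⟨?_, fun w hw => hvu.2 w (hle hw)⟩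
        rw [SimpleGraph.deleteEdges_adj]
        refine ⟨hvu.1, fun he => ?_⟩
        rcases Sym2.eq_iff.mp he with ⟨h1, -⟩ | ⟨h1, -⟩
        · exact hvu.1.ne h1
        · exact hzv h1
      obtain ⟨π, hπ⟩ := ih _ (lt_of_le_of_ne hle hne) (hle.trans hH)
      refine ⟨π, hπ.mono hI hle hH fun p q hpq hnot => ?_⟩
      rw [SimpleGraph.deleteEdges_adj, not_and, not_not] at hnot
      rcases Sym2.eq_iff.mp (hnot hpq) with ⟨rfl, rfl⟩ | ⟨rfl, rfl⟩
      · exact Or.inl ⟨v, hfirst, hlt⟩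
      · exact Or.inr ⟨v, hfirst, hlt⟩

/-- Tan's theorem. -/
theorem exists_isStablePartition [Finite V] (hI : I.Strict) :
    ∃ π : Equiv.Perm V, I.IsStablePartition π :=
  let ⟨π, hπ⟩ := exists_stablePartitionOn hI I.G le_rfl
  ⟨π, hπ.isStablePartition⟩

end PrefGraph

/-! ### A structured programming layer on top of the word RAM -/

namespace WordRAM

/-- The state seen by structured programs: variables and unboundedly many separate arrays. -/
structure AState where
  /-- the values of the variables -/
  var : ℕ → ℕ
  /-- the contents of the arrays -/
  arr : ℕ → ℕ → ℕ

namespace AState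

/-- Write `v` into the variable `x`. -/
def setVar (s : AState) (x v : ℕ) : AState :=
  { s with var := Function.update s.var x v }

/-- Write `v` into the cell `i` of the array `A`. -/
def setArr (s : AState) (A i v : ℕ) : AState :=
  { s with arr := Function.update s.arr A (Function.update (s.arr A) i v) }

@[simp]
theorem var_setVar (s : AState) (x v y : ℕ) :
    (s.setVar x v).var y = if y = x then v else s.var y := by
  simp [setVar, Function.update_apply]

@[simp]
theorem arr_setVar (s : AState) (x v : ℕ) : (s.setVar x v).arr = s.arr := rfl

@[simp]
theorem var_setArr (s : AState) (A i v : ℕ) : (s.setArr A i v).var = s.var := rfl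

@[simp]
theorem arr_setArr (s : AState) (A i v B : ℕ) :
    (s.setArr A i v).arr B = if B = A then Function.update (s.arr A) i v else s.arr B := by
  simp [setArr, Function.update_apply]

end AState

/-- Arithmetic expressions with array accesses. -/
inductive Expr where
  /-- the value of a variable -/
  | var (x : ℕ)
  /-- a literal -/
  | lit (k : ℕ)
  /-- an arithmetic operation -/
  | op (o : ArithOp) (a b : Expr)
  /-- an array access -/
  | get (A : ℕ) (i : Expr)

namespace Expr

/-- The value of an expression. -/
def eval (s : AState) : Expr → ℕ
  | var x => s.var x
  | lit k => k
  | op o a b => o.eval (a.eval s) (b.eval s)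
  | get A i => s.arr A (i.eval s)

/-- The evaluation succeeds on a machine with words up to `W` and arrays of size `S`. The variables
are the registers below `40`, and `16` arrays are available. -/
def Ok (W S : ℕ) (s : AState) : Expr → Prop
  | var x => x < 40
  | lit k => k ≤ 2
  | op o a b => a.Ok W S s ∧ b.Ok W S s ∧ (o = .div → b.eval s ≠ 0) ∧
      o.eval (a.eval s) (b.eval s) ≤ W
  | get A i => i.Ok W S s ∧ A < 16 ∧ i.eval s < S

/-- The number of machine steps of an evaluation. -/
def cost : Expr → ℕ
  | var _ => 2
  | lit _ => 1
  | op _ a b => a.cost + b.cost + 1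
  | get _ i => i.cost + 4

/-- Code that evaluates an expression into the register `d`, using registers from `d` on. The array
`A` starts at the address `A * S`, where `S` is the content of register `40`. -/
def code : Expr → ℕ → Program
  | var x, d => .seq (.const d 0) (.arith .add d x d)
  | lit k, d => .const d k
  | op o a b, d => .seq (a.code d) (.seq (b.code (d + 1)) (.arith o d d (d + 1)))
  | get A i, d => .seq (i.code d) (.seq (.const (d + 1) A) (.seq (.arith .mul (d + 1) (d + 1) 40)
      (.seq (.arith .add d d (d + 1)) (.load d d))))

instance : Add Expr := ⟨op .add⟩
instance : Sub Expr := ⟨op .sub⟩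
instance : Mul Expr := ⟨op .mul⟩
instance : Div Expr := ⟨op .div⟩

section

variable (W S : ℕ) (s : AState) (a b : Expr)

@[simp] theorem eval_var (x : ℕ) : (var x).eval s = s.var x := rfl
@[simp] theorem eval_lit (k : ℕ) : (lit k).eval s = k := rfl
@[simp] theorem eval_get (A : ℕ) : (get A a).eval s = s.arr A (a.eval s) := rfl
@[simp] theorem eval_add : (a + b).eval s = a.eval s + b.eval s := rfl
@[simp] theorem eval_sub : (a - b).eval s = a.eval s - b.eval s := rfl
@[simp] theorem eval_mul : (a * b).eval s = a.eval s * b.eval s := rfl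
@[simp] theorem eval_div : (a / b).eval s = a.eval s / b.eval s := rfl

@[simp] theorem ok_var (x : ℕ) : (var x).Ok W S s ↔ x < 40 := Iff.rfl
@[simp] theorem ok_lit (k : ℕ) : (lit k).Ok W S s ↔ k ≤ 2 := Iff.rfl
@[simp] theorem ok_get (A : ℕ) :
    (get A a).Ok W S s ↔ a.Ok W S s ∧ A < 16 ∧ a.eval s < S := Iff.rfl
@[simp] theorem ok_add :
    (a + b).Ok W S s ↔ a.Ok W S s ∧ b.Ok W S s ∧ a.eval s + b.eval s ≤ W := by
  change _ ∧ _ ∧ (ArithOp.add = .div → _) ∧ _ ↔ _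
  simp [ArithOp.eval]
@[simp] theorem ok_sub :
    (a - b).Ok W S s ↔ a.Ok W S s ∧ b.Ok W S s ∧ a.eval s - b.eval s ≤ W := by
  change _ ∧ _ ∧ (ArithOp.sub = .div → _) ∧ _ ↔ _
  simp [ArithOp.eval]
@[simp] theorem ok_mul :
    (a * b).Ok W S s ↔ a.Ok W S s ∧ b.Ok W S s ∧ a.eval s * b.eval s ≤ W := by
  change _ ∧ _ ∧ (ArithOp.mul = .div → _) ∧ _ ↔ _
  simp [ArithOp.eval]
@[simp] theorem ok_div : (a / b).Ok W S s ↔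
    a.Ok W S s ∧ b.Ok W S s ∧ b.eval s ≠ 0 ∧ a.eval s / b.eval s ≤ W := by
  change _ ∧ _ ∧ (ArithOp.div = .div → _) ∧ _ ↔ _
  simp [ArithOp.eval]

end

end Expr

/-- The machine state `σ` represents the abstract state `s`. -/
structure Sim (W S : ℕ) (σ : State) (s : AState) : Prop where
  var : ∀ x < 40, σ.reg x = s.var x
  base : σ.reg 40 = S
  arr : ∀ A < 16, ∀ i < S, σ.mem (A * S + i) = s.arr A i
  reg_le : ∀ r, σ.reg r ≤ W
  mem_le : ∀ i, σ.mem i ≤ W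

theorem State.reg_setReg (s : State) (d k r : ℕ) :
    (s.setReg d k).reg r = if r = d then k else s.reg r := by
  simp [State.setReg, Function.update_apply]

theorem Sim.setReg {W S : ℕ} {σ : State} {s : AState} (h : Sim W S σ s) {d k : ℕ} (hd : 40 < d)
    (hk : k ≤ W) : Sim W S (σ.setReg d k) s where
  var x hx := by
    rw [State.reg_setReg, if_neg (by omega), h.var x hx]
  base := by
    rw [State.reg_setReg, if_neg (by omega), h.base]
  arr := h.arr
  reg_le r := by
    rw [State.reg_setReg]
    split_ifs
    · exact hk
    · exact h.reg_le r
  mem_le := h.mem_le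

theorem Sim.setVar {W S : ℕ} {σ : State} {s : AState} (h : Sim W S σ s) {x k : ℕ} (hx : x < 40)
    (hk : k ≤ W) : Sim W S (σ.setReg x k) (s.setVar x k) where
  var y hy := by
    rw [State.reg_setReg, AState.var_setVar, h.var y hy]
  base := by
    rw [State.reg_setReg, if_neg (by omega), h.base]
  arr := h.arr
  reg_le r := by
    rw [State.reg_setReg]
    split_ifs
    · exact hk
    · exact h.reg_le r
  mem_le := h.mem_le

theorem mul_add_eq_iff {S a b i j : ℕ} (hi : i < S) (hj : j < S) :
    a * S + i = b * S + j ↔ a = b ∧ i = j := by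
  refine ⟨fun h => ?_, fun h => by rw [h.1, h.2]⟩
  have hS : 0 < S := by omega
  have h1 : (a * S + i) / S = a := by
    rw [Nat.mul_comm, Nat.mul_add_div hS, Nat.div_eq_of_lt hi, Nat.add_zero]
  have h2 : (b * S + j) / S = b := by
    rw [Nat.mul_comm, Nat.mul_add_div hS, Nat.div_eq_of_lt hj, Nat.add_zero]
  have h3 : a = b := by rw [← h1, h, h2]
  subst h3
  exact ⟨rfl, by omega⟩

theorem Sim.setArr {W S : ℕ} {σ : State} {s : AState} (h : Sim W S σ s) {A i k : ℕ} (hi : i < S)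
    (hk : k ≤ W) : Sim W S (σ.setMem (A * S + i) k) (s.setArr A i k) where
  var := h.var
  base := h.base
  arr B hB j hj := by
    have hiff := mul_add_eq_iff (a := B) (b := A) hj hi
    rw [AState.arr_setArr]
    simp only [State.setMem, Function.update_apply, hiff, h.arr B hB j hj]
    by_cases hBA : B = A
    · subst hBA
      simp [Function.update_apply]
    · simp [hBA]
  reg_le := h.reg_le
  mem_le a := by
    simp only [State.setMem, Function.update_apply]
    split_ifs
    · exact hk
    · exact h.mem_le a

/-- The compiled expression computes its value, and changes neither the abstract state nor the
registers below `d`. -/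
theorem Expr.exec_code {W S : ℕ} (hW : 16 * S + 16 ≤ W) {s : AState} (e : Expr) :
    ∀ {d : ℕ} {σ : State}, 40 < d → Sim W S σ s → e.Ok W S s →
      ∃ σ', Exec W (e.code d) σ e.cost σ' ∧ Sim W S σ' s ∧ σ'.reg d = e.eval s ∧
        ∀ r < d, σ'.reg r = σ.reg r := by
  induction e with
  | var x =>
    intro d σ hd hσ hok
    have hx : x < 40 := hok
    have hval : ArithOp.add.eval ((σ.setReg d 0).reg x) ((σ.setReg d 0).reg d) = s.var x := by
      simp only [ArithOp.eval, State.reg_setReg, if_neg (show x ≠ d by omega), if_true,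
        Nat.add_zero, hσ.var x hx]
    have hle : s.var x ≤ W := by
      rw [← hσ.var x hx]
      exact hσ.reg_le x
    have h2 := Exec.arith (W := W) (σ.setReg d 0) .add d x d (by simp) (by rw [hval]; exact hle)
    rw [hval] at h2
    refine ⟨_, Exec.seq (Exec.const σ d 0 (Nat.zero_le _)) h2,
      (hσ.setReg hd (Nat.zero_le _)).setReg hd hle, ?_, fun r hr => ?_⟩
    · simp [State.reg_setReg]
    · simp [State.reg_setReg, Nat.ne_of_lt hr]
  | lit k =>
    intro d σ hd hσ hok
    have hk : k ≤ W := le_trans hok (by omega)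
    refine ⟨_, Exec.const σ d k hk, hσ.setReg hd hk, ?_, fun r hr => ?_⟩
    · simp [State.reg_setReg]
    · simp [State.reg_setReg, Nat.ne_of_lt hr]
  | op o a b iha ihb =>
    intro d σ hd hσ hok
    obtain ⟨ha, hb, h0, hle⟩ := hok
    obtain ⟨σ₁, he₁, hσ₁, hv₁, hf₁⟩ := iha hd hσ ha
    obtain ⟨σ₂, he₂, hσ₂, hv₂, hf₂⟩ := ihb (d := d + 1) (by omega) hσ₁ hb
    have hd₂ : σ₂.reg d = a.eval s := by rw [hf₂ d (by omega), hv₁]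
    have h3 := Exec.arith (W := W) σ₂ o d d (d + 1) (by rw [hv₂]; exact h0)
      (by rw [hv₂, hd₂]; exact hle)
    rw [hv₂, hd₂] at h3
    refine ⟨_, ?_, hσ₂.setReg hd hle, ?_, fun r hr => ?_⟩
    · have := Exec.seq he₁ (Exec.seq he₂ h3)
      rwa [← Nat.add_assoc] at this
    · simp [State.reg_setReg, Expr.eval]
    · rw [State.reg_setReg, if_neg (by omega), hf₂ r (by omega), hf₁ r hr]
  | get A i ih =>
    intro d σ hd hσ hok
    obtain ⟨hi, hA, hS⟩ := hok
    obtain ⟨σ₁, he₁, hσ₁, hv₁, hf₁⟩ := ih hd hσ hi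
    have hAW : A ≤ W := by omega
    have hAS : A * S ≤ 15 * S := Nat.mul_le_mul_right _ (by omega)
    have e2 := Exec.const (W := W) σ₁ (d + 1) A hAW
    have hσ₂ := hσ₁.setReg (d := d + 1) (by omega) hAW
    generalize hτ₂ : σ₁.setReg (d + 1) A = σ₂ at e2 hσ₂
    have hr₂ : σ₂.reg (d + 1) = A := by simp [← hτ₂, State.reg_setReg]
    have hf₂ : ∀ r ≤ d, σ₂.reg r = σ₁.reg r := fun r hr => by
      rw [← hτ₂, State.reg_setReg, if_neg (by omega)]
    have e3 := Exec.arith (W := W) σ₂ .mul (d + 1) (d + 1) 40 (by simp)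
      (by simp only [ArithOp.eval, hr₂, hσ₂.base]; omega)
    simp only [ArithOp.eval, hr₂, hσ₂.base] at e3
    have hσ₃ := hσ₂.setReg (d := d + 1) (k := A * S) (by omega) (by omega)
    generalize hτ₃ : σ₂.setReg (d + 1) (A * S) = σ₃ at e3 hσ₃
    have hr₃ : σ₃.reg (d + 1) = A * S := by simp [← hτ₃, State.reg_setReg]
    have hf₃ : ∀ r ≤ d, σ₃.reg r = σ₁.reg r := fun r hr => by
      rw [← hτ₃, State.reg_setReg, if_neg (by omega), hf₂ r hr]
    have e4 := Exec.arith (W := W) σ₃ .add d d (d + 1) (by simp)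
      (by simp only [ArithOp.eval, hr₃, hf₃ d le_rfl, hv₁]; omega)
    simp only [ArithOp.eval, hr₃, hf₃ d le_rfl, hv₁] at e4
    have hσ₄ := hσ₃.setReg (d := d) (k := i.eval s + A * S) hd (by omega)
    generalize hτ₄ : σ₃.setReg d (i.eval s + A * S) = σ₄ at e4 hσ₄
    have hr₄ : σ₄.reg d = A * S + i.eval s := by
      simp [← hτ₄, State.reg_setReg, Nat.add_comm]
    have hf₄ : ∀ r < d, σ₄.reg r = σ₁.reg r := fun r hr => by
      rw [← hτ₄, State.reg_setReg, if_neg (by omega), hf₃ r hr.le]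
    have e5 := Exec.load (W := W) σ₄ d d
    rw [hr₄, hσ₄.arr A hA _ hS] at e5
    have hle : s.arr A (i.eval s) ≤ W := by
      rw [← hσ₄.arr A hA _ hS]
      exact hσ₄.mem_le _
    refine ⟨_, ?_, hσ₄.setReg hd hle, ?_, fun r hr => ?_⟩
    · exact Exec.seq he₁ (Exec.seq e2 (Exec.seq e3 (Exec.seq e4 e5)))
    · simp [State.reg_setReg, Expr.eval]
    · rw [State.reg_setReg, if_neg (by omega), hf₄ r hr, hf₁ r hr]

/-- `x := e` -/
def setP (x : ℕ) (e : Expr) : Program :=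
  .seq (e.code 41) (.seq (.const 42 0) (.arith .add x 41 42))

/-- `A[i] := e` -/
def putP (A : ℕ) (i e : Expr) : Program :=
  .seq (i.code 41) (.seq (e.code 42) (.seq (.const 43 A) (.seq (.arith .mul 43 43 40)
    (.seq (.arith .add 41 43 41) (.store 41 42)))))

/-- if `a < b` run `p`, otherwise run `q` -/
def iteP (a b : Expr) (p q : Program) : Program :=
  .seq (a.code 41) (.seq (b.code 42) (.ite 41 42 p q))

/-- as long as `a < b`, run `p` -/
def whileP (a b : Expr) (p : Program) : Program :=
  .seq (a.code 41) (.seq (b.code 42) (.while 41 42 (.seq p (.seq (a.code 41) (b.code 42)))))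

/-- Total correctness with a time bound: started in any machine state that represents `s`, the
program `p` halts within `T` steps in a machine state that represents a state with `Q`. -/
def Runs (W S : ℕ) (p : Program) (T : ℕ) (s : AState) (Q : AState → Prop) : Prop :=
  ∀ σ, Sim W S σ s → ∃ t σ' s', Exec W p σ t σ' ∧ t ≤ T ∧ Sim W S σ' s' ∧ Q s'

namespace Runs

variable {W S : ℕ} {p q : Program} {s : AState} {Q R : AState → Prop} {T T' T₁ T₂ : ℕ}

theorem mono (h : Runs W S p T s Q) (hT : T ≤ T') (hQ : ∀ s', Q s' → R s') :
    Runs W S p T' s R := by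
  intro σ hσ
  obtain ⟨t, σ', s', he, ht, hs, hq⟩ := h σ hσ
  exact ⟨t, σ', s', he, ht.trans hT, hs, hQ s' hq⟩

theorem seq (h : Runs W S p T₁ s fun s' => Runs W S q T₂ s' Q) (hT : T₁ + T₂ ≤ T) :
    Runs W S (.seq p q) T s Q := by
  intro σ hσ
  obtain ⟨t₁, σ₁, s₁, he₁, ht₁, hs₁, hq₁⟩ := h σ hσ
  obtain ⟨t₂, σ₂, s₂, he₂, ht₂, hs₂, hq₂⟩ := hq₁ σ₁ hs₁
  exact ⟨t₁ + t₂, σ₂, s₂, Exec.seq he₁ he₂, by omega, hs₂, hq₂⟩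

theorem set (hW : 16 * S + 16 ≤ W) {x v : ℕ} {e : Expr} (hv : e.eval s = v) (hok : e.Ok W S s)
    (hQ : Q (s.setVar x v)) (hx : x < 40 := by decide) (hT : e.cost + 2 ≤ T := by decide) :
    Runs W S (setP x e) T s Q := by
  subst hv
  intro σ hσ
  obtain ⟨σ₁, he₁, hσ₁, hv₁, -⟩ := e.exec_code hW (d := 41) (by omega) hσ hok
  have hle : e.eval s ≤ W := hv₁ ▸ hσ₁.reg_le 41
  have e2 := Exec.const (W := W) σ₁ 42 0 (Nat.zero_le _)
  have hσ₂ := hσ₁.setReg (d := 42) (k := 0) (by omega) (Nat.zero_le _)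
  have hv : ArithOp.add.eval ((σ₁.setReg 42 0).reg 41) ((σ₁.setReg 42 0).reg 42) = e.eval s := by
    simp [ArithOp.eval, State.reg_setReg, hv₁]
  have e3 := Exec.arith (W := W) (σ₁.setReg 42 0) .add x 41 42 (by simp) (by rw [hv]; exact hle)
  rw [hv] at e3
  exact ⟨_, _, _, Exec.seq he₁ (Exec.seq e2 e3), by omega, hσ₂.setVar hx hle, hQ⟩

theorem put (hW : 16 * S + 16 ≤ W) {A j v : ℕ} {i e : Expr} (hj : i.eval s = j)
    (hv : e.eval s = v) (hi : i.Ok W S s) (hok : e.Ok W S s) (hjS : j < S)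
    (hQ : Q (s.setArr A j v)) (hA : A < 16 := by decide)
    (hT : i.cost + e.cost + 4 ≤ T := by decide) : Runs W S (putP A i e) T s Q := by
  subst hj hv
  intro σ hσ
  have hAS : A * S ≤ 15 * S := Nat.mul_le_mul_right _ (by omega)
  obtain ⟨σ₁, he₁, hσ₁, hv₁, -⟩ := i.exec_code hW (d := 41) (by omega) hσ hi
  obtain ⟨σ₂, he₂, hσ₂, hv₂, hf₂⟩ := e.exec_code hW (d := 42) (by omega) hσ₁ hok
  rw [← hf₂ 41 (by omega)] at hv₁
  have hle : e.eval s ≤ W := hv₂ ▸ hσ₂.reg_le 42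
  have hAW : A ≤ W := by omega
  have e3 := Exec.const (W := W) σ₂ 43 A hAW
  have hσ₃ := hσ₂.setReg (d := 43) (by omega) hAW
  have e4 := Exec.arith (W := W) (σ₂.setReg 43 A) .mul 43 43 40 (by simp)
    (by simp only [ArithOp.eval, hσ₃.base]; simp only [State.reg_setReg, if_true]; omega)
  simp only [ArithOp.eval, hσ₃.base] at e4
  simp only [State.reg_setReg, if_true] at e4
  have hσ₄ := hσ₃.setReg (d := 43) (k := A * S) (by omega) (by omega)
  generalize hτ : (σ₂.setReg 43 A).setReg 43 (A * S) = σ₄ at e4 hσ₄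
  have h41 : σ₄.reg 41 = i.eval s := by simp [← hτ, State.reg_setReg, hv₁]
  have h42 : σ₄.reg 42 = e.eval s := by simp [← hτ, State.reg_setReg, hv₂]
  have h43 : σ₄.reg 43 = A * S := by simp [← hτ, State.reg_setReg]
  have e5 := Exec.arith (W := W) σ₄ .add 41 43 41 (by simp)
    (by simp only [ArithOp.eval, h41, h43]; omega)
  simp only [ArithOp.eval, h41, h43] at e5
  have hσ₅ := hσ₄.setReg (d := 41) (k := A * S + i.eval s) (by omega) (by omega)
  have e6 := Exec.store (W := W) (σ₄.setReg 41 (A * S + i.eval s)) 41 42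
  simp only [State.reg_setReg, if_true, if_neg (show ¬ 42 = 41 by omega), h42] at e6
  exact ⟨_, _, _, Exec.seq he₁ (Exec.seq he₂ (Exec.seq e3 (Exec.seq e4 (Exec.seq e5 e6)))),
    by omega, hσ₅.setArr hjS hle, hQ⟩

theorem ite (hW : 16 * S + 16 ≤ W) {a b : Expr} (ha : a.Ok W S s) (hb : b.Ok W S s)
    (hp : a.eval s < b.eval s → Runs W S p (T - (a.cost + b.cost + 1)) s Q)
    (hq : b.eval s ≤ a.eval s → Runs W S q (T - (a.cost + b.cost + 1)) s Q)
    (hT : a.cost + b.cost + 1 ≤ T := by decide) :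
    Runs W S (iteP a b p q) T s Q := by
  intro σ hσ
  obtain ⟨σ₁, he₁, hσ₁, hv₁, -⟩ := a.exec_code hW (d := 41) (by omega) hσ ha
  obtain ⟨σ₂, he₂, hσ₂, hv₂, hf₂⟩ := b.exec_code hW (d := 42) (by omega) hσ₁ hb
  rw [← hf₂ 41 (by omega)] at hv₁
  by_cases hc : a.eval s < b.eval s
  · obtain ⟨t, σ', s', he, ht, hs, hQ⟩ := hp hc σ₂ hσ₂
    exact ⟨_, σ', s', Exec.seq he₁ (Exec.seq he₂ (Exec.ite_true (by rwa [hv₁, hv₂]) he)),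
      by omega, hs, hQ⟩
  · obtain ⟨t, σ', s', he, ht, hs, hQ⟩ := hq (not_lt.mp hc) σ₂ hσ₂
    exact ⟨_, σ', s', Exec.seq he₁ (Exec.seq he₂ (Exec.ite_false (by rwa [hv₁, hv₂]) he)),
      by omega, hs, hQ⟩

theorem set_seq (hW : 16 * S + 16 ≤ W) {x v : ℕ} {e : Expr} (hv : e.eval s = v)
    (hok : e.Ok W S s) (h : Runs W S q (T - (e.cost + 2)) (s.setVar x v) Q)
    (hx : x < 40 := by decide) (hT : e.cost + 2 ≤ T := by decide) :
    Runs W S (.seq (setP x e) q) T s Q :=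
  seq (set hW hv hok h hx le_rfl) (by omega)

theorem put_seq (hW : 16 * S + 16 ≤ W) {A j v : ℕ} {i e : Expr} (hj : i.eval s = j)
    (hv : e.eval s = v) (hi : i.Ok W S s) (hok : e.Ok W S s) (hjS : j < S)
    (h : Runs W S q (T - (i.cost + e.cost + 4)) (s.setArr A j v) Q) (hA : A < 16 := by decide)
    (hT : i.cost + e.cost + 4 ≤ T := by decide) : Runs W S (.seq (putP A i e) q) T s Q :=
  seq (put hW hj hv hi hok hjS h hA le_rfl) (by omega)

/-- A while loop. The index of the invariant `J` decreases with every iteration, and so bounds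
their number. -/
theorem whileLoop (hW : 16 * S + 16 ≤ W) {a b : Expr} {C m : ℕ} (J : ℕ → AState → Prop)
    (hok : ∀ k s, J k s → a.Ok W S s ∧ b.Ok W S s)
    (hstep : ∀ k s, J k s → a.eval s < b.eval s →
      Runs W S p C s fun s' => ∃ k' < k, J k' s')
    (h0 : J m s) (hQ : ∀ k s, J k s → b.eval s ≤ a.eval s → Q s)
    (hT : m * (C + a.cost + b.cost + 1) + (a.cost + b.cost + 1) ≤ T) :
    Runs W S (whileP a b p) T s Q := by
  have key : ∀ k σ s, Sim W S σ s → J k s → σ.reg 41 = a.eval s → σ.reg 42 = b.eval s →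
      ∃ t σ' s', Exec W (.while 41 42 (.seq p (.seq (a.code 41) (b.code 42)))) σ t σ' ∧
        t ≤ k * (C + a.cost + b.cost + 1) + 1 ∧ Sim W S σ' s' ∧ Q s' := by
    intro k
    induction k using Nat.strong_induction_on with
    | _ k ih =>
      intro σ s hσ hJ h41 h42
      by_cases hc : a.eval s < b.eval s
      · obtain ⟨t₁, σ₁, s₁, he₁, ht₁, hσ₁, k', hk', hJ'⟩ := hstep k s hJ hc σ hσ
        obtain ⟨hoka, hokb⟩ := hok k' s₁ hJ'
        obtain ⟨σ₂, he₂, hσ₂, hv₂, -⟩ := a.exec_code hW (d := 41) (by omega) hσ₁ hoka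
        obtain ⟨σ₃, he₃, hσ₃, hv₃, hf₃⟩ := b.exec_code hW (d := 42) (by omega) hσ₂ hokb
        rw [← hf₃ 41 (by omega)] at hv₂
        obtain ⟨t₄, σ₄, s₄, he₄, ht₄, hσ₄, hQ₄⟩ := ih k' hk' σ₃ s₁ hσ₃ hJ' hv₂ hv₃
        refine ⟨_, σ₄, s₄, Exec.while_loop (by rwa [h41, h42])
          (Exec.seq he₁ (Exec.seq he₂ he₃)) he₄, ?_, hσ₄, hQ₄⟩
        have : (k' + 1) * (C + a.cost + b.cost + 1) ≤ k * (C + a.cost + b.cost + 1) :=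
          Nat.mul_le_mul_right _ hk'
        rw [Nat.succ_mul] at this
        omega
      · exact ⟨1, σ, s, Exec.while_done (by rwa [h41, h42]), by omega, hσ,
          hQ k s hJ (not_lt.mp hc)⟩
  intro σ hσ
  obtain ⟨hoka, hokb⟩ := hok m s h0
  obtain ⟨σ₁, he₁, hσ₁, hv₁, -⟩ := a.exec_code hW (d := 41) (by omega) hσ hoka
  obtain ⟨σ₂, he₂, hσ₂, hv₂, hf₂⟩ := b.exec_code hW (d := 42) (by omega) hσ₁ hokb
  rw [← hf₂ 41 (by omega)] at hv₁
  obtain ⟨t, σ', s', he, ht, hs, hQ'⟩ := key m σ₂ s hσ₂ h0 hv₁ hv₂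
  exact ⟨_, σ', s', Exec.seq he₁ (Exec.seq he₂ he), by omega, hs, hQ'⟩

/-- A loop with exactly `m` iterations. -/
theorem loop (hW : 16 * S + 16 ≤ W) {a b : Expr} {C : ℕ} (m : ℕ) (J : ℕ → AState → Prop)
    (hok : ∀ k s, J k s → k ≤ m → a.Ok W S s ∧ b.Ok W S s ∧ (a.eval s < b.eval s ↔ k < m))
    (hstep : ∀ k s, J k s → k < m → Runs W S p C s (J (k + 1)))
    (h0 : J 0 s) (hT : m * (C + a.cost + b.cost + 1) + (a.cost + b.cost + 1) ≤ T) :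
    Runs W S (whileP a b p) T s (J m) := by
  refine Runs.whileLoop hW (m := m) (fun j s => ∃ k, k + j = m ∧ J k s) ?_ ?_
    ⟨0, by omega, h0⟩ ?_ hT
  · rintro j s ⟨k, hk, hJ⟩
    exact ⟨(hok k s hJ (by omega)).1, (hok k s hJ (by omega)).2.1⟩
  · rintro j s ⟨k, hk, hJ⟩ hc
    have hkm := (hok k s hJ (by omega)).2.2.mp hc
    exact (hstep k s hJ hkm).mono le_rfl fun s' hJ' => ⟨j - 1, by omega, k + 1, by omega, hJ'⟩
  · rintro j s ⟨k, hk, hJ⟩ hc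
    have h1 := (hok k s hJ (by omega)).2.2
    have : k = m := by
      by_contra hne
      exact absurd (h1.mpr (by omega)) (not_lt.mpr hc)
    exact this ▸ hJ

end Runs

end WordRAM

/-! ### Deferred acceptance -/

namespace DeferredAcceptance

/-- Preference lists of the agents `0, …, n - 1`: `pref v` lists, for `k < deg v`, the neighbours
of `v` with respect to `Adj` in the order of decreasing value. -/
structure IsPrefTable (n : ℕ) (Adj : ℕ → ℕ → Prop) (val : ℕ → ℕ → ℕ) (deg : ℕ → ℕ)
    (pref : ℕ → ℕ → ℕ) : Prop where
  deg_le : ∀ v < n, deg v ≤ n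
  lt : ∀ v < n, ∀ k < deg v, pref v k < n
  adj : ∀ v < n, ∀ k < deg v, Adj v (pref v k)
  surj : ∀ v < n, ∀ w < n, Adj v w → ∃ k < deg v, pref v k = w
  sorted : ∀ v < n, ∀ j k, j ≤ k → k < deg v → val v (pref v k) ≤ val v (pref v j)

/-- What deferred acceptance has to know about an ordinally stable matching `M`: `Sat x y` stands
for `M(x, ⪰ y) = 1`, and `Zero y x` for `M(y, x) = 0`. -/
structure IsWitness (n : ℕ) (Adj : ℕ → ℕ → Prop) (val : ℕ → ℕ → ℕ) (Sat Zero : ℕ → ℕ → Prop) :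
    Prop where
  adj_symm : ∀ x y, Adj x y → Adj y x
  strict : ∀ v < n, ∀ x < n, ∀ y < n, Adj v x → Adj v y → x ≠ y → val v x ≠ val v y
  sat : ∀ y < n, ∀ x < n, Adj y x → (∀ z < n, Adj y z → val y x < val y z → Zero y z) → Sat x y
  zero : ∀ x < n, ∀ y < n, ∀ z < n, Adj x y → Adj x z → Sat x y → val x z < val x y → Zero z x

/-- The state of deferred acceptance when the agents `0, …, u` have entered and `cur` is the agent
that proposes next: `v` has made the first `ptr v` proposals of its list, `hold x` is `y + 1` if `x`
holds the proposal of `y` and `0` if it holds none, and `h` agents hold a proposal. -/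
structure Inv (n : ℕ) (Adj : ℕ → ℕ → Prop) (deg : ℕ → ℕ) (pref : ℕ → ℕ → ℕ)
    (Sat Zero : ℕ → ℕ → Prop) (ptr hold : ℕ → ℕ) (u cur h : ℕ) : Prop where
  ptr_le : ∀ v < n, ptr v ≤ deg v
  hold_le : ∀ x < n, hold x ≤ n
  sat : ∀ x < n, ∀ y, hold x = y + 1 → Sat x y ∧ Adj x y
  inj : ∀ x < n, ∀ x' < n, ∀ y, hold x = y + 1 → hold x' = y + 1 → x = x'
  rej : ∀ v < n, ∀ k < ptr v, hold (pref v k) = v + 1 ∨ Zero v (pref v k)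
  held : ∀ x < n, ∀ y, hold x = y + 1 → y ≤ u ∧ y ≠ cur
  done : ∀ v < n, v ≤ u → v ≠ cur → (∃ x < n, hold x = v + 1) ∨ ptr v = deg v
  cur_le : cur ≤ u
  cur_eq : n ≤ u → cur = n
  u_le : u ≤ n
  card : h = ((Finset.range n).filter fun x => hold x ≠ 0).card

variable {n : ℕ} {Adj : ℕ → ℕ → Prop} {val : ℕ → ℕ → ℕ} {deg : ℕ → ℕ} {pref : ℕ → ℕ → ℕ}
  {Sat Zero : ℕ → ℕ → Prop} {ptr hold : ℕ → ℕ} {u cur h : ℕ}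

theorem Inv.init (hn : 0 < n) (hptr : ∀ v < n, ptr v = 0) (hhold : ∀ x < n, hold x = 0) :
    Inv n Adj deg pref Sat Zero ptr hold 0 0 0 where
  ptr_le v hv := by simp [hptr v hv]
  hold_le x hx := by simp [hhold x hx]
  sat x hx y hy := by simp [hhold x hx] at hy
  inj x hx _ _ y hy := by simp [hhold x hx] at hy
  rej v hv k hk := by simp [hptr v hv] at hk
  held x hx y hy := by simp [hhold x hx] at hy
  done v hv h0 h1 := by omega
  cur_le := le_rfl
  cur_eq h0 := by omega
  u_le := Nat.zero_le _
  card := by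
    symm
    rw [Finset.card_eq_zero, Finset.filter_eq_empty_iff]
    intro x hx
    simp [hhold x (Finset.mem_range.mp hx)]

theorem Inv.cur_lt (hi : Inv n Adj deg pref Sat Zero ptr hold u cur h) (hu : u < n) : cur < n :=
  lt_of_le_of_lt hi.cur_le hu

/-- The proposer gives up: it has exhausted its list, and the next agent enters. -/
theorem Inv.exhausted (hi : Inv n Adj deg pref Sat Zero ptr hold u cur h) (hu : u < n)
    (hd : deg cur ≤ ptr cur) : Inv n Adj deg pref Sat Zero ptr hold (u + 1) (u + 1) h where
  ptr_le := hi.ptr_le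
  hold_le := hi.hold_le
  sat := hi.sat
  inj := hi.inj
  rej := hi.rej
  held x hx y hy := by
    have := (hi.held x hx y hy).1
    omega
  done v hv h0 h1 := by
    by_cases hc : v = cur
    · subst hc
      exact Or.inr (le_antisymm (hi.ptr_le v hv) hd)
    · exact hi.done v hv (by omega) hc
  cur_le := le_rfl
  cur_eq h0 := by omega
  u_le := hu
  card := hi.card

/-- If the next agent `x` on the list of the proposer `cur` accepts its proposal, then `x` is
saturated by the neighbours it weakly prefers to `cur`, because all the agents that `cur` prefers
to `x` have rejected it. -/
theorem Inv.sat_next (hp : IsPrefTable n Adj val deg pref) (hw : IsWitness n Adj val Sat Zero)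
    (hi : Inv n Adj deg pref Sat Zero ptr hold u cur h) (hu : u < n) (hd : ptr cur < deg cur) :
    Sat (pref cur (ptr cur)) cur := by
  have hc := hi.cur_lt hu
  refine hw.sat cur hc _ (hp.lt cur hc _ hd) (hp.adj cur hc _ hd) fun z hz haz hlt => ?_
  obtain ⟨k, hk, rfl⟩ := hp.surj cur hc z hz haz
  have hkp : k < ptr cur := by
    by_contra hge
    exact absurd hlt (not_lt.mpr (hp.sorted cur hc _ _ (not_lt.mp hge) hk))
  exact (hi.rej cur hc k hkp).resolve_left fun h => (hi.held _ hz _ h).2 rfl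

/-- The agent `x` holds no proposal yet and accepts; the next agent enters. -/
theorem Inv.accept_empty (hp : IsPrefTable n Adj val deg pref)
    (hw : IsWitness n Adj val Sat Zero) (hi : Inv n Adj deg pref Sat Zero ptr hold u cur h)
    (hu : u < n) (hd : ptr cur < deg cur) {x : ℕ} (hx : pref cur (ptr cur) = x)
    (h0 : hold x = 0) :
    Inv n Adj deg pref Sat Zero (Function.update ptr cur (ptr cur + 1))
      (Function.update hold x (cur + 1)) (u + 1) (u + 1) (h + 1) := by
  have hc := hi.cur_lt hu
  have hsat := hi.sat_next hp hw hu hd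
  have hxn := hp.lt cur hc _ hd
  have hadj := hw.adj_symm _ _ (hp.adj cur hc _ hd)
  rw [hx] at hsat hxn hadj
  have hother : ∀ y, y ≠ cur → ∀ z, Function.update hold x (cur + 1) z = y + 1 ↔
      hold z = y + 1 := by
    intro y hy z
    rw [Function.update_apply]
    split_ifs with hz
    · subst hz
      rw [h0]
      omega
    · rfl
  have hself : ∀ z, z < n → Function.update hold x (cur + 1) z = cur + 1 → z = x := by
    intro z hz h1
    by_contra hzx
    rw [Function.update_of_ne hzx] at h1
    exact (hi.held z hz cur h1).2 rfl
  refine ⟨fun v hv => ?_, fun z hz => ?_, fun z hz y hy => ?_, fun z hz z' hz' y hy hy' => ?_,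
    fun v hv k hk => ?_, fun z hz y hy => ?_, fun v hv h1 h2 => ?_, le_rfl, fun h1 => by omega,
    hu, ?_⟩
  · rw [Function.update_apply]
    split_ifs with hvc
    · subst hvc
      exact hd
    · exact hi.ptr_le v hv
  · rw [Function.update_apply]
    split_ifs
    · exact hc
    · exact hi.hold_le z hz
  · by_cases hyc : y = cur
    · subst hyc
      rw [hself z hz hy]
      exact ⟨hsat, hadj⟩
    · exact hi.sat z hz y ((hother y hyc z).mp hy)
  · by_cases hyc : y = cur
    · subst hyc
      rw [hself z hz hy, hself z' hz' hy']
    · exact hi.inj z hz z' hz' y ((hother y hyc z).mp hy) ((hother y hyc z').mp hy')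
  · by_cases hvc : v = cur
    · subst hvc
      rw [Function.update_self] at hk
      rcases Nat.lt_succ_iff_lt_or_eq.mp hk with hk | rfl
      · right
        exact (hi.rej v hv k hk).resolve_left fun h1 =>
          (hi.held _ (hp.lt v hv k (by omega)) _ h1).2 rfl
      · left
        rw [hx, Function.update_self]
    · rw [Function.update_of_ne hvc] at hk
      rw [hother v hvc]
      exact hi.rej v hv k hk
  · by_cases hyc : y = cur
    · have := hi.cur_le
      omega
    · have := (hi.held z hz y ((hother y hyc z).mp hy)).1
      omega
  · by_cases hvc : v = cur
    · subst hvc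
      exact Or.inl ⟨x, hxn, Function.update_self _ _ _⟩
    · rw [Function.update_of_ne hvc]
      rcases hi.done v hv (by omega) hvc with ⟨z, hz, h3⟩ | h3
      · exact Or.inl ⟨z, hz, (hother v hvc z).mpr h3⟩
      · exact Or.inr h3
  · have : ((Finset.range n).filter fun z => Function.update hold x (cur + 1) z ≠ 0) =
        insert x ((Finset.range n).filter fun z => hold z ≠ 0) := by
      ext z
      simp only [Finset.mem_filter, Finset.mem_range, Finset.mem_insert, Function.update_apply]
      by_cases hzx : z = x
      · subst hzx
        simp [hxn]
      · simp [hzx]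
    rw [this, Finset.card_insert_of_notMem (by simp [h0]), hi.card]

/-- The agent `x` prefers the proposer to the agent `y` it holds; `y` proposes next. -/
theorem Inv.accept_swap (hp : IsPrefTable n Adj val deg pref)
    (hw : IsWitness n Adj val Sat Zero) (hi : Inv n Adj deg pref Sat Zero ptr hold u cur h)
    (hu : u < n) (hd : ptr cur < deg cur) {x y : ℕ} (hx : pref cur (ptr cur) = x)
    (h0 : hold x = y + 1) (hlt : val x y < val x cur) :
    Inv n Adj deg pref Sat Zero (Function.update ptr cur (ptr cur + 1))
      (Function.update hold x (cur + 1)) u y h := by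
  have hc := hi.cur_lt hu
  have hsat := hi.sat_next hp hw hu hd
  have hxn := hp.lt cur hc _ hd
  have hadj := hw.adj_symm _ _ (hp.adj cur hc _ hd)
  rw [hx] at hsat hxn hadj
  have hyn : y < n := by
    have := hi.hold_le x hxn
    omega
  obtain ⟨hyu, hyc⟩ := hi.held x hxn y h0
  have hzero : Zero y x := hw.zero x hxn cur hc y hyn hadj (hi.sat x hxn y h0).2 hsat hlt
  have hother : ∀ v, v ≠ cur → v ≠ y → ∀ z, Function.update hold x (cur + 1) z = v + 1 ↔
      hold z = v + 1 := by
    intro v hv hvy z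
    rw [Function.update_apply]
    split_ifs with hz
    · subst hz
      rw [h0]
      omega
    · rfl
  have hself : ∀ z, z < n → Function.update hold x (cur + 1) z = cur + 1 → z = x := by
    intro z hz h1
    by_contra hzx
    rw [Function.update_of_ne hzx] at h1
    exact (hi.held z hz cur h1).2 rfl
  have hfree : ∀ z < n, Function.update hold x (cur + 1) z ≠ y + 1 := by
    intro z hz h1
    rw [Function.update_apply] at h1
    split_ifs at h1 with hzx
    · omega
    · exact hzx (hi.inj z hz x hxn y h1 h0)
  refine ⟨fun v hv => ?_, fun z hz => ?_, fun z hz v hy => ?_, fun z hz z' hz' v hy hy' => ?_,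
    fun v hv k hk => ?_, fun z hz v hy => ?_, fun v hv h1 h2 => ?_, hyu, fun h1 => by omega,
    hi.u_le, ?_⟩
  · rw [Function.update_apply]
    split_ifs with hvc
    · subst hvc
      exact hd
    · exact hi.ptr_le v hv
  · rw [Function.update_apply]
    split_ifs
    · exact hc
    · exact hi.hold_le z hz
  · by_cases hvc : v = cur
    · subst hvc
      rw [hself z hz hy]
      exact ⟨hsat, hadj⟩
    · have hvy : v ≠ y := by
        rintro rfl
        exact hfree z hz hy
      exact hi.sat z hz v ((hother v hvc hvy z).mp hy)
  · by_cases hvc : v = cur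
    · subst hvc
      rw [hself z hz hy, hself z' hz' hy']
    · have hvy : v ≠ y := by
        rintro rfl
        exact hfree z hz hy
      exact hi.inj z hz z' hz' v ((hother v hvc hvy z).mp hy) ((hother v hvc hvy z').mp hy')
  · by_cases hvc : v = cur
    · subst hvc
      rw [Function.update_self] at hk
      rcases Nat.lt_succ_iff_lt_or_eq.mp hk with hk | rfl
      · right
        exact (hi.rej v hv k hk).resolve_left fun h1 =>
          (hi.held _ (hp.lt v hv k (by omega)) _ h1).2 rfl
      · left
        rw [hx, Function.update_self]
    · rw [Function.update_of_ne hvc] at hk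
      by_cases hvy : v = y
      · subst hvy
        right
        rcases hi.rej v hv k hk with h1 | h1
        · have hkn := hp.lt v hv k (lt_of_lt_of_le hk (hi.ptr_le v hv))
          rw [hi.inj _ hkn x hxn v h1 h0]
          exact hzero
        · exact h1
      · rw [hother v hvc hvy]
        exact hi.rej v hv k hk
  · have hvy : v ≠ y := by
      rintro rfl
      exact hfree z hz hy
    refine ⟨?_, hvy⟩
    by_cases hvc : v = cur
    · rw [hvc]
      exact hi.cur_le
    · exact (hi.held z hz v ((hother v hvc hvy z).mp hy)).1
  · by_cases hvc : v = cur
    · subst hvc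
      exact Or.inl ⟨x, hxn, Function.update_self _ _ _⟩
    · rw [Function.update_of_ne hvc]
      rcases hi.done v hv h1 hvc with ⟨z, hz, h3⟩ | h3
      · exact Or.inl ⟨z, hz, (hother v hvc h2 z).mpr h3⟩
      · exact Or.inr h3
  · rw [hi.card]
    congr 1
    ext z
    simp only [Finset.mem_filter, Finset.mem_range, Function.update_apply]
    by_cases hzx : z = x
    · subst hzx
      simp [h0]
    · simp [hzx]

/-- The agent `x` prefers the agent `y` it holds and rejects the proposer. -/
theorem Inv.reject (hp : IsPrefTable n Adj val deg pref)
    (hw : IsWitness n Adj val Sat Zero) (hi : Inv n Adj deg pref Sat Zero ptr hold u cur h)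
    (hu : u < n) (hd : ptr cur < deg cur) {x y : ℕ} (hx : pref cur (ptr cur) = x)
    (h0 : hold x = y + 1) (hle : val x cur ≤ val x y) :
    Inv n Adj deg pref Sat Zero (Function.update ptr cur (ptr cur + 1)) hold u cur h := by
  have hc := hi.cur_lt hu
  have hxn := hp.lt cur hc _ hd
  have hadj := hw.adj_symm _ _ (hp.adj cur hc _ hd)
  rw [hx] at hxn hadj
  have hyn : y < n := by
    have := hi.hold_le x hxn
    omega
  obtain ⟨hyu, hyc⟩ := hi.held x hxn y h0
  obtain ⟨hsat, hxy⟩ := hi.sat x hxn y h0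
  have hzero : Zero cur x := hw.zero x hxn y hyn cur hc hxy hadj hsat
    (lt_of_le_of_ne hle (hw.strict x hxn cur hc y hyn hadj hxy hyc.symm))
  refine ⟨fun v hv => ?_, hi.hold_le, hi.sat, hi.inj, fun v hv k hk => ?_, hi.held,
    fun v hv h1 h2 => ?_, hi.cur_le, hi.cur_eq, hi.u_le, hi.card⟩
  · rw [Function.update_apply]
    split_ifs with hvc
    · subst hvc
      exact hd
    · exact hi.ptr_le v hv
  · by_cases hvc : v = cur
    · subst hvc
      rw [Function.update_self] at hk
      rcases Nat.lt_succ_iff_lt_or_eq.mp hk with hk | rfl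
      · exact hi.rej v hv k hk
      · exact Or.inr (hx ▸ hzero)
    · rw [Function.update_of_ne hvc] at hk
      exact hi.rej v hv k hk
  · rw [Function.update_of_ne h2]
    exact hi.done v hv h1 h2

/-- After deferred acceptance, every agent is held or has been rejected by all its neighbours. There
are as many held agents as holders; so the holders are exactly the fully matched agents. -/
theorem Inv.card_eq (hp : IsPrefTable n Adj val deg pref)
    (hi : Inv n Adj deg pref Sat Zero ptr hold n cur h) (Full : ℕ → Prop) [DecidablePred Full]
    (hfull : ∀ x < n, ∀ y < n, Sat x y → Full x)
    (hzero : ∀ v < n, (∀ x < n, Adj v x → Zero v x) → ¬ Full v) :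
    h = ((Finset.range n).filter Full).card := by
  have hpos : ∀ x, hold x ≠ 0 → hold x = hold x - 1 + 1 := fun x hx => by omega
  rw [hi.card]
  refine le_antisymm (Finset.card_le_card fun x hx => ?_) ?_
  · rw [Finset.mem_filter, Finset.mem_range] at hx ⊢
    have h1 := hpos x hx.2
    have h2 := hi.hold_le x hx.1
    exact ⟨hx.1, hfull x hx.1 (hold x - 1) (by omega) (hi.sat x hx.1 _ h1).1⟩
  · have hsub : (Finset.range n).filter Full ⊆
        ((Finset.range n).filter fun x => hold x ≠ 0).image fun x => hold x - 1 := by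
      intro v hv
      rw [Finset.mem_filter, Finset.mem_range] at hv
      obtain ⟨hvn, hv⟩ := hv
      rw [Finset.mem_image]
      by_contra hno
      refine hzero v hvn (fun x hx hadj => ?_) hv
      obtain ⟨k, hk, rfl⟩ := hp.surj v hvn x hx hadj
      have hheld : ∀ z < n, hold z ≠ v + 1 := by
        intro z hz h1
        exact hno ⟨z, Finset.mem_filter.mpr ⟨Finset.mem_range.mpr hz, by omega⟩, by omega⟩
      have hcn : v ≠ cur := by
        have := hi.cur_eq le_rfl
        omega
      rcases hi.done v hvn hvn.le hcn with ⟨z, hz, h1⟩ | h1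
      · exact absurd h1 (hheld z hz)
      · exact (hi.rej v hvn k (by omega)).resolve_left (hheld _ hx)
    exact (Finset.card_le_card hsub).trans Finset.card_image_le

end DeferredAcceptance

/-! ### Radix sort on lists -/

namespace RadixSort

/-- One pass of radix sort: the elements are distributed to `n` buckets, and the buckets are
concatenated. -/
def pass (n : ℕ) (dig : ℕ → ℕ) (L : List ℕ) : List ℕ :=
  (List.range n).flatMap fun d => L.filter fun p => dig p = d

theorem pass_perm {n : ℕ} {dig : ℕ → ℕ} {L : List ℕ} (hdig : ∀ p ∈ L, dig p < n) :
    (pass n dig L).Perm L := by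
  have key : ∀ m, (pass m dig L).Perm (L.filter fun p => dig p < m) := by
    intro m
    induction m with
    | zero => simp [pass]
    | succ m ih =>
      have h1 : pass (m + 1) dig L = pass m dig L ++ L.filter fun p => dig p = m := by
        simp [pass, List.range_succ]
      rw [h1]
      refine (ih.append_right _).trans ?_
      have h2 := List.filter_append_perm (fun p => decide (dig p < m))
        (L.filter fun p => dig p < m + 1)
      rw [List.filter_filter, List.filter_filter] at h2
      convert h2 using 2
      · refine List.filter_congr fun p _ => ?_
        simp only [← Bool.decide_and, decide_eq_decide]
        omega
      · refine List.filter_congr fun p _ => ?_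
        rw [← decide_not, ← Bool.decide_and, decide_eq_decide]
        omega
  refine (key n).trans ?_
  rw [List.filter_eq_self.mpr fun p hp => by simpa using hdig p hp]

/-- A pass preserves the order within the buckets, and so it extends a list that is sorted by the
lower digits to one that is sorted by one digit more. -/
theorem pass_sorted {n P : ℕ} {key : ℕ → ℕ} {L : List ℕ} (hP : 0 < P)
    (hL : L.Pairwise fun p q => key p % P ≤ key q % P) :
    (pass n (fun p => key p / P % n) L).Pairwise fun p q => key p % (P * n) ≤ key q % (P * n) := by
  unfold pass
  rw [List.pairwise_flatMap]
  refine ⟨fun d _ => ?_, ?_⟩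
  · rw [List.pairwise_filter]
    refine hL.imp fun {p q} hpq hp hq => ?_
    replace hp : key p / P % n = d := decide_eq_true_eq.mp hp
    replace hq : key q / P % n = d := decide_eq_true_eq.mp hq
    rw [Nat.mod_mul, Nat.mod_mul, hp, hq]
    omega
  · refine List.pairwise_lt_range.imp fun {d e} hde p hp q hq => ?_
    have hp' : key p / P % n = d := decide_eq_true_eq.mp (List.mem_filter.mp hp).2
    have hq' : key q / P % n = e := decide_eq_true_eq.mp (List.mem_filter.mp hq).2
    rw [Nat.mod_mul, Nat.mod_mul, hp', hq']
    have h1 := Nat.mod_lt (key p) hP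
    have h2 : P * (d + 1) ≤ P * e := Nat.mul_le_mul_left _ hde
    rw [Nat.mul_succ] at h2
    omega

end RadixSort

/-! ### The program -/

namespace WordRAM

infixr:70 " ;; " => Program.seq

open WordRAM.Expr

/-- The keys of the ordered pairs: with `D` the sum of all denominators, the key of a pair with
satisfaction `a / b` is `a * D ^ 2 / b`, rounded down. In the variables, `v₀ = n`, `v₁ = τ`,
`v₂ = n ^ 2`, and `v₅` is the sum of all keys. Array `0` is the input, array `1` holds the keys and
array `2` the list of all pairs. -/
def keysProgram : Program :=
  setP 2 (var 0 * var 0) ;;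
  whileP (var 7) (var 2) (
    setP 3 (var 3 + get 0 (lit 2 * var 7 + lit 1)) ;;
    setP 7 (var 7 + lit 1)) ;;
  setP 4 (var 3 * var 3) ;;
  setP 7 (lit 0) ;;
  whileP (var 7) (var 2) (
    putP 1 (var 7) (get 0 (lit 2 * var 7) * var 4 / get 0 (lit 2 * var 7 + lit 1)) ;;
    setP 5 (var 5 + get 1 (var 7)) ;;
    putP 2 (var 7) (var 7) ;;
    setP 7 (var 7 + lit 1)) ;;
  setP 6 (lit 1)

/-- One pass of radix sort with base `n` on the list in array `2`, for the digit of weight `v₆`.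
Bucket `d` consists of the cells from `d * n ^ 2` on of array `4`, and array `3` holds the
numbers of elements of the buckets. -/
def passProgram : Program :=
  setP 7 (lit 0) ;;
  whileP (var 7) (var 0) (
    putP 3 (var 7) (lit 0) ;;
    setP 7 (var 7 + lit 1)) ;;
  setP 7 (lit 0) ;;
  whileP (var 7) (var 2) (
    setP 8 (get 2 (var 7)) ;;
    setP 9 (get 1 (var 8) / var 6) ;;
    setP 9 (var 9 - var 9 / var 0 * var 0) ;;
    putP 4 (var 9 * var 2 + get 3 (var 9)) (var 8) ;;
    putP 3 (var 9) (get 3 (var 9) + lit 1) ;;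
    setP 7 (var 7 + lit 1)) ;;
  setP 9 (lit 0) ;;
  setP 10 (lit 0) ;;
  setP 11 (lit 0) ;;
  whileP (var 10) (var 2) (
    iteP (var 11) (get 3 (var 9)) (
      putP 2 (var 10) (get 4 (var 9 * var 2 + var 11)) ;;
      setP 10 (var 10 + lit 1) ;;
      setP 11 (var 11 + lit 1)) (
      setP 9 (var 9 + lit 1) ;;
      setP 11 (lit 0)))

/-- Radix sort. -/
def sortProgram : Program :=
  whileP (var 6) (var 5 + lit 1) (passProgram ;; setP 6 (var 6 * var 0))

/-- The preference lists, from the sorted list of all pairs: the list of `u` is in the cells from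
`u * n ^ 2` on of array `5`, and its length in array `6`. -/
def listsProgram : Program :=
  setP 7 (lit 0) ;;
  whileP (var 7) (var 2) (
    setP 8 (get 2 (var 2 - lit 1 - var 7)) ;;
    setP 12 (var 8 / var 0) ;;
    setP 15 (var 8 - var 12 * var 0) ;;
    iteP (lit 0) (get 1 (var 8) + get 1 (var 15 * var 0 + var 12)) (
      putP 5 (var 12 * var 2 + get 6 (var 12)) (var 15) ;;
      putP 6 (var 12) (get 6 (var 12) + lit 1) ;;
      setP 7 (var 7 + lit 1)) (
      setP 7 (var 7 + lit 1)))

/-- Deferred acceptance, with `ptr` in array `7`, `hold` in array `8`, and `u`, `cur` and `h` in the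
variables `12`, `13` and `14`. -/
def acceptanceProgram : Program :=
  setP 12 (lit 0) ;;
  setP 13 (lit 0) ;;
  setP 14 (lit 0) ;;
  whileP (var 12) (var 0) (
    iteP (get 7 (var 13)) (get 6 (var 13)) (
      setP 15 (get 5 (var 13 * var 2 + get 7 (var 13))) ;;
      putP 7 (var 13) (get 7 (var 13) + lit 1) ;;
      iteP (get 8 (var 15)) (lit 1) (
        putP 8 (var 15) (var 13 + lit 1) ;;
        setP 14 (var 14 + lit 1) ;;
        setP 12 (var 12 + lit 1) ;;
        setP 13 (var 12)) (
        setP 16 (get 8 (var 15) - lit 1) ;;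
        iteP (get 1 (var 15 * var 0 + var 16)) (get 1 (var 15 * var 0 + var 13)) (
          putP 8 (var 15) (var 13 + lit 1) ;;
          setP 13 (var 16)) (
          setP 16 (lit 0)))) (
      setP 12 (var 12 + lit 1) ;;
      setP 13 (var 12)))

/-- The decision program for Max-Full OSM. The first two steps set the size `n ^ 3` of the
arrays. -/
def maxFullProgram : Program :=
  .arith .mul 40 0 0 ;;
  .arith .mul 40 40 0 ;;
  keysProgram ;;
  sortProgram ;;
  listsProgram ;;
  acceptanceProgram ;;
  iteP (var 14) (var 1) (setP 0 (lit 0)) (setP 0 (lit 1))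

/-! ### Analysis of the program -/

/-- The sizes that occur in the analysis: `N = n ^ 2` pairs, arrays of size `S = n ^ 3`, and words
up to `W`. -/
structure Sizes (n N S W : ℕ) : Prop where
  two_le : 2 ≤ n
  sq : N = n * n
  size : S = n * N
  word : 16 * S + 16 ≤ W

namespace Sizes

variable {n N S W : ℕ}

theorem le_sq (h : Sizes n N S W) : 2 * n ≤ N := by
  rw [h.sq]
  exact Nat.mul_le_mul_right _ h.two_le

theorem two_mul_le (h : Sizes n N S W) : 2 * N ≤ S := by
  rw [h.size]
  exact Nat.mul_le_mul_right _ h.two_le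

theorem addr_lt (h : Sizes n N S W) {d k : ℕ} (hd : d < n) (hk : k < N) : d * N + k < S := by
  have : (d + 1) * N ≤ n * N := Nat.mul_le_mul_right _ hd
  rw [Nat.succ_mul] at this
  rw [h.size]
  omega

theorem pair_lt (h : Sizes n N S W) {u v : ℕ} (hu : u < n) (hv : v < n) : u * n + v < N := by
  have : (u + 1) * n ≤ n * n := Nat.mul_le_mul_right _ hu
  rw [Nat.succ_mul] at this
  rw [h.sq]
  omega

end Sizes

/-- What holds from the computation of the keys on. -/
structure Base (n τ N : ℕ) (key : ℕ → ℕ) (s : AState) : Prop where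
  var₀ : s.var 0 = n
  var₁ : s.var 1 = τ
  var₂ : s.var 2 = N
  keys : ∀ p < N, s.arr 1 p = key p

theorem Base.setVar {n τ N : ℕ} {key : ℕ → ℕ} {s : AState} (h : Base n τ N key s) {x v : ℕ}
    (hx : 2 < x := by decide) : Base n τ N key (s.setVar x v) where
  var₀ := by rw [AState.var_setVar, if_neg (by omega), h.var₀]
  var₁ := by rw [AState.var_setVar, if_neg (by omega), h.var₁]
  var₂ := by rw [AState.var_setVar, if_neg (by omega), h.var₂]
  keys := h.keys

theorem Base.setArr {n τ N : ℕ} {key : ℕ → ℕ} {s : AState} (h : Base n τ N key s) {A i v : ℕ}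
    (hA : 1 < A := by decide) : Base n τ N key (s.setArr A i v) where
  var₀ := h.var₀
  var₁ := h.var₁
  var₂ := h.var₂
  keys p hp := by rw [AState.arr_setArr, if_neg (by omega), h.keys p hp]

/-- What holds during the sorting phase: `B` is the sum of all keys and `P` the weight of the
current digit, and the arrays `6`, `7` and `8` are still empty. -/
structure Sorting (n τ N : ℕ) (key : ℕ → ℕ) (B P : ℕ) (s : AState) : Prop extends
    Base n τ N key s where
  var₅ : s.var 5 = B
  var₆ : s.var 6 = P
  empty₆ : ∀ i < n, s.arr 6 i = 0
  empty₇ : ∀ i < n, s.arr 7 i = 0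
  empty₈ : ∀ i < n, s.arr 8 i = 0

theorem Sorting.setVar {n τ N B P : ℕ} {key : ℕ → ℕ} {s : AState} (h : Sorting n τ N key B P s)
    {x v : ℕ} (hx : 6 < x := by decide) : Sorting n τ N key B P (s.setVar x v) where
  toBase := h.toBase.setVar (by omega)
  var₅ := by rw [AState.var_setVar, if_neg (by omega), h.var₅]
  var₆ := by rw [AState.var_setVar, if_neg (by omega), h.var₆]
  empty₆ := h.empty₆
  empty₇ := h.empty₇
  empty₈ := h.empty₈

theorem Sorting.setArr {n τ N B P : ℕ} {key : ℕ → ℕ} {s : AState} (h : Sorting n τ N key B P s)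
    {A i v : ℕ} (hA : 1 < A := by decide) (hA' : A < 6 := by decide) :
    Sorting n τ N key B P (s.setArr A i v) where
  toBase := h.toBase.setArr hA
  var₅ := h.var₅
  var₆ := h.var₆
  empty₆ j hj := by rw [AState.arr_setArr, if_neg (by omega), h.empty₆ j hj]
  empty₇ j hj := by rw [AState.arr_setArr, if_neg (by omega), h.empty₇ j hj]
  empty₈ j hj := by rw [AState.arr_setArr, if_neg (by omega), h.empty₈ j hj]

/-- The first `k` values of `f`, as a list. -/
abbrev prefixList (f : ℕ → ℕ) (k : ℕ) : List ℕ := (List.range k).map f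

theorem prefixList_succ (f : ℕ → ℕ) (k : ℕ) : prefixList f (k + 1) = prefixList f k ++ [f k] := by
  simp [prefixList, List.range_succ]

theorem prefixList_congr {f g : ℕ → ℕ} {k : ℕ} (h : ∀ i < k, f i = g i) :
    prefixList f k = prefixList g k :=
  List.map_congr_left fun i hi => h i (List.mem_range.mp hi)

/-- If the list `g` of bucket sizes and the buckets `b d` represent filters of a list of the first
`k` values of `f`, then so they do after adding the next value to its bucket. -/
theorem bucket_step {N n k : ℕ} {f cnt b : ℕ → ℕ} {Sel : ℕ → ℕ → Bool} {out : ℕ → ℕ} (hk : k < N)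
    (h : ∀ d < n, prefixList (fun j => b (d * N + j)) (cnt d) =
      ((prefixList f k).filter (Sel d)).map out)
    {e : ℕ} (he : e < n) (hsel : ∀ d < n, Sel d (f k) = true ↔ d = e) :
    cnt e < N ∧ ∀ d < n,
      prefixList (fun j => Function.update b (e * N + cnt e) (out (f k)) (d * N + j))
        (Function.update cnt e (cnt e + 1) d) =
      ((prefixList f (k + 1)).filter (Sel d)).map out := by
  have hlt : ∀ d < n, cnt d < N := by
    intro d hd
    have h1 := congrArg List.length (h d hd)
    simp only [prefixList, List.length_map, List.length_range] at h1
    have h2 := List.length_filter_le (Sel d) (List.map f (List.range k))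
    simp only [List.length_map, List.length_range] at h2
    omega
  refine ⟨hlt e he, fun d hd => ?_⟩
  have hold : ∀ m ≤ cnt d, (d ≠ e ∨ m ≤ cnt e) →
      prefixList (fun j => Function.update b (e * N + cnt e) (out (f k)) (d * N + j)) m =
      prefixList (fun j => b (d * N + j)) m := by
    intro m hm hde
    refine prefixList_congr fun j hj => ?_
    refine Function.update_of_ne (fun h1 => ?_) _ _
    have hd' := hlt d hd
    rw [mul_add_eq_iff (by omega) (hlt e he)] at h1
    rcases hde with h2 | h2
    · exact h2 h1.1
    · omega
  rw [prefixList_succ, List.filter_append, List.map_append, ← h d hd]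
  by_cases hde : d = e
  · subst hde
    rw [Function.update_self, prefixList_succ, hold _ le_rfl (Or.inr le_rfl), Function.update_self,
      List.filter_singleton, (hsel d hd).mpr rfl]
    rfl
  · have h1 : Sel d (f k) = false := by
      rw [Bool.eq_false_iff]
      exact fun h2 => hde ((hsel d hd).mp h2)
    rw [Function.update_of_ne hde, hold _ le_rfl (Or.inl hde), List.filter_singleton, h1]
    simp

variable {n τ N S W B P : ℕ} {key : ℕ → ℕ}

/-- The program for a pass implements `RadixSort.pass`. -/
theorem runs_passProgram (hz : Sizes n N S W) (hP : 0 < P) (hkey : ∀ p < N, key p ≤ B)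
    (hB : B ≤ W) {s : AState} (hs : Sorting n τ N key B P s)
    (hL : (prefixList (s.arr 2) N).Perm (List.range N)) :
    Runs W S passProgram (1000 * N) s fun s' => Sorting n τ N key B P s' ∧
      prefixList (s'.arr 2) N =
        RadixSort.pass n (fun p => key p / P % n) (prefixList (s.arr 2) N) := by
  have hW := hz.word
  have hnN := hz.le_sq
  have h2n := hz.two_le
  have hNS := hz.two_mul_le
  set f := s.arr 2 with hf
  have hfN : ∀ k < N, f k < N := by
    intro k hk
    have : f k ∈ prefixList f N := List.mem_map_of_mem (List.mem_range.mpr hk)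
    exact List.mem_range.mp (hL.mem_iff.mp this)
  set dig : ℕ → ℕ := fun p => key p / P % n with hdig
  have hdign : ∀ p, dig p < n := fun p => Nat.mod_lt _ (by omega)
  unfold passProgram
  -- the summands are the bounds for the successive assignments and loops of the program
  refine Runs.mono (T := 12 + (n * (50 + 2 + 2 + 1) + 5 + (3 + (N * (200 + 2 + 2 + 1) + 5 +
    (3 + (3 + (3 + ((N + n) * (200 + 2 + 2 + 1) + 5)))))))) (Q := _) ?_ (by omega) fun _ h => h
  refine Runs.seq (Runs.set hW (v := 0) rfl (by simp) ?_) (T₁ := 12) le_rfl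
  refine Runs.seq (Runs.mono (Runs.loop hW (C := 50) n (fun k s => Sorting n τ N key B P s ∧
    s.arr 2 = f ∧ s.var 7 = k ∧ ∀ d < k, s.arr 3 d = 0) ?_ ?_ ?_ le_rfl) le_rfl ?_) le_rfl
  · rintro k s ⟨hs, -, h7, -⟩ hk
    simp [hs.var₀, h7]
  · rintro k s ⟨hs, h2, h7, h3⟩ hk
    refine Runs.put_seq hW (j := k) (v := 0) (by simp [h7]) rfl (by simp) (by simp) (by omega) ?_
    refine Runs.set hW (v := k + 1) (by simp [h7]) (by simp [h7]; omega) ?_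
    refine ⟨hs.setArr.setVar, by simp [h2], by simp, fun d hd => ?_⟩
    simp only [AState.arr_setVar, AState.arr_setArr, if_true, Function.update_apply]
    split_ifs with hdk
    · rfl
    · exact h3 d (by omega)
  · exact ⟨hs.setVar, rfl, by simp, by simp⟩
  rintro s₁ ⟨hs₁, h2₁, -, h3₁⟩
  refine Runs.seq (Runs.set hW (v := 0) rfl (by simp) ?_) (T₁ := 3) le_rfl
  refine Runs.seq (Runs.mono (Runs.loop hW (C := 200) N (fun k s => Sorting n τ N key B P s ∧
    s.arr 2 = f ∧ s.var 7 = k ∧ ∀ d < n, prefixList (fun j => s.arr 4 (d * N + j)) (s.arr 3 d) =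
      ((prefixList f k).filter fun p => dig p = d).map id) ?_ ?_ ?_ le_rfl) le_rfl ?_) le_rfl
  · rintro k s ⟨hs, -, h7, -⟩ hk
    simp [hs.var₂, h7]
  · rintro k s ⟨hs, h2, h7, h3⟩ hk
    have hfk := hfN k hk
    have hkey' := hkey _ hfk
    have hle1 : key (f k) / P ≤ key (f k) := Nat.div_le_self _ _
    have hle2 : key (f k) / P / n * n ≤ key (f k) / P := Nat.div_mul_le_self _ _
    have hle3 : key (f k) / P / n ≤ key (f k) / P := Nat.div_le_self _ _
    obtain ⟨hcnt, hstep⟩ := bucket_step hk h3 (hdign (f k)) fun d _ => by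
      rw [decide_eq_true_eq, eq_comm]
    have haddr := hz.addr_lt (hdign (f k)) hcnt
    have hd := hdign (f k)
    have hmod : key (f k) / P - key (f k) / P / n * n = dig (f k) := by
      have := Nat.div_add_mod (key (f k) / P) n
      rw [Nat.mul_comm] at this
      simp only [hdig]
      omega
    refine Runs.set_seq hW (v := f k) (by simp [h7, h2]) (by simp [h7]; omega) ?_
    refine Runs.set_seq hW (v := key (f k) / P) (by simp [hs.var₆, hs.keys _ hfk])
      (by simp [hs.var₆, hs.keys _ hfk]; omega) ?_
    refine Runs.set_seq hW (v := dig (f k)) (by simp [hs.var₀, hmod]) (by simp [hs.var₀]; omega) ?_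
    refine Runs.put_seq hW (j := dig (f k) * N + s.arr 3 (dig (f k))) (v := f k) (by simp [hs.var₂])
      (by simp) (by simp [hs.var₂]; omega) (by simp) haddr ?_
    refine Runs.put_seq hW (j := dig (f k)) (v := s.arr 3 (dig (f k)) + 1) (by simp)
      (by simp) (by simp) (by simp; omega) (by omega) ?_
    refine Runs.set hW (v := k + 1) (by simp [h7]) (by simp [h7]; omega) ?_
    refine ⟨hs.setVar.setVar.setVar.setArr.setArr.setVar, by simp [h2], by simp, fun d hd => ?_⟩
    simpa using hstep d hd
  · refine ⟨hs₁.setVar, h2₁, by simp, fun d hd => ?_⟩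
    simp [h3₁ d hd, prefixList]
  rintro s₂ ⟨hs₂, h2₂, -, h3₂⟩
  simp only [List.map_id] at h3₂
  set cnt := s₂.arr 3 with hcnt
  set b := s₂.arr 4 with hb
  set F : ℕ → List ℕ := fun d => prefixList (fun j => b (d * N + j)) (cnt d) with hF
  have hpass : RadixSort.pass n dig (prefixList f N) = (List.range n).flatMap F := by
    simp only [RadixSort.pass, List.flatMap_def]
    congr 1
    exact List.map_congr_left fun d hd => (h3₂ d (List.mem_range.mp hd)).symm
  have hlen : ((List.range n).flatMap F).length = N := by
    rw [← hpass, (RadixSort.pass_perm fun p _ => hdign p).length_eq]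
    simp
  have hcntN : ∀ d < n, cnt d ≤ N := by
    intro d hd
    have h1 := congrArg List.length (h3₂ d hd)
    have h2 := List.length_filter_le (fun p => decide (dig p = d)) (prefixList f N)
    simp only [prefixList, List.length_map, List.length_range] at h1 h2
    omega
  refine Runs.seq (Runs.set hW (v := 0) rfl (by simp) ?_) (T₁ := 3) le_rfl
  refine Runs.seq (Runs.set hW (v := 0) rfl (by simp) ?_) (T₁ := 3) le_rfl
  refine Runs.seq (Runs.set hW (v := 0) rfl (by simp) ?_) (T₁ := 3) le_rfl
  refine Runs.whileLoop hW (C := 200) (m := N + n) (fun m s => Sorting n τ N key B P s ∧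
    s.arr 3 = cnt ∧ s.arr 4 = b ∧ ∃ d k j, s.var 9 = d ∧ s.var 10 = j ∧ s.var 11 = k ∧
      m + j + d = N + n ∧ j ≤ N ∧ d ≤ n ∧ (d < n → k ≤ cnt d) ∧ (d = n → k = 0) ∧
      prefixList (s.arr 2) j =
        (List.range d).flatMap F ++ prefixList (fun j => b (d * N + j)) k) ?_ ?_ ?_ ?_ ?_
  · rintro m s ⟨hs, -⟩
    simp
  · rintro m s ⟨hs, h3, h4, d, k, j, h9, h10, h11, hm, hj, hd, hk, hk0, hl⟩ hlt
    simp only [eval_var, h10, hs.var₂] at hlt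
    have hdn : d < n := by
      by_contra hge
      obtain rfl : d = n := by omega
      have h1 := congrArg List.length hl
      rw [hk0 rfl, List.length_append, hlen] at h1
      simp at h1
      omega
    have hcd := hcntN d hdn
    have hkd := hk hdn
    refine Runs.ite hW (by simp) (by simp [h9]; omega) (fun hlt' => ?_) (fun hle => ?_)
    · simp only [eval_var, eval_get, h11, h9, h3] at hlt'
      have haddr := hz.addr_lt hdn (show k < N by omega)
      refine Runs.put_seq hW (j := j) (v := b (d * N + k)) (by simp [h10])
        (by simp [h9, h11, h4, hs.var₂]) (by simp) (by simp [h9, h11, hs.var₂]; omega)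
        (by omega) ?_
      refine Runs.set_seq hW (v := j + 1) (by simp [h10]) (by simp [h10]; omega) ?_
      refine Runs.set hW (v := k + 1) (by simp [h11]) (by simp [h11]; omega) ?_
      refine ⟨m - 1, by omega, hs.setArr.setVar.setVar, by simp [h3], by simp [h4], d, k + 1, j + 1,
        by simp [h9], by simp, by simp, by omega, by omega, by omega, by omega, by omega, ?_⟩
      simp only [AState.arr_setVar, AState.arr_setArr, if_true]
      rw [prefixList_succ, Function.update_self, prefixList_succ, ← List.append_assoc, ← hl]
      congr 1
      exact prefixList_congr fun i hi => Function.update_of_ne (by omega) _ _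
    · simp only [eval_var, eval_get, h11, h9, h3] at hle
      refine Runs.set_seq hW (v := d + 1) (by simp [h9]) (by simp [h9]; omega) ?_
      refine Runs.set hW (v := 0) rfl (by simp) ?_
      refine ⟨m - 1, by omega, hs.setVar.setVar, h3, h4, d + 1, 0, j,
        by simp, by simp [h10], by simp, by omega, by omega, by omega, by omega, by omega, ?_⟩
      simp only [AState.arr_setVar]
      rw [hl, List.range_succ, List.flatMap_append, show k = cnt d by omega]
      simp [hF]
  · exact ⟨hs₂.setVar.setVar.setVar, rfl, rfl, 0, 0, 0, by simp, by simp, by simp, by omega,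
      by omega, by omega, by omega, by omega, by simp⟩
  · rintro m s ⟨hs, -, -, d, k, j, -, h10, -, -, hj, hd, hk, hk0, hl⟩ hle
    simp only [eval_var, h10, hs.var₂] at hle
    obtain rfl : j = N := by omega
    refine ⟨hs, ?_⟩
    rw [hpass, hl]
    -- the concatenation of all buckets has no more elements than this initial segment
    have hsub : (List.range d).flatMap F ++ prefixList (fun i => b (d * j + i)) k <+:
        (List.range n).flatMap F := by
      rcases Nat.lt_or_ge d n with hdn | hdn
      · obtain ⟨e, rfl⟩ := Nat.exists_eq_add_of_lt hdn
        rw [show d + e + 1 = d + 1 + e by omega, List.range_add, List.flatMap_append,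
          List.range_succ, List.flatMap_append]
        refine List.IsPrefix.trans ?_ (List.prefix_append _ _)
        refine (List.prefix_append_right_inj _).mpr ?_
        obtain ⟨c, hc⟩ := Nat.exists_eq_add_of_le (hk hdn)
        simp only [List.flatMap_singleton, hF, prefixList, hc, List.range_add, List.map_append]
        exact List.prefix_append _ _
      · obtain rfl : d = n := by omega
        rw [hk0 rfl, show prefixList (fun i => b (d * j + i)) 0 = [] from rfl, List.append_nil]
    refine hsub.eq_of_length ?_
    rw [hlen, ← hl]
    simp
  · simp [Expr.cost]

/-- Radix sort needs no more than `m` passes for keys below `n ^ m`. -/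
theorem runs_sortProgram (hz : Sizes n N S W) (hkey : ∀ p < N, key p ≤ B) {m : ℕ}
    (hm : B < n ^ m) (hB : (B + 1) * n ≤ W) {s : AState} (hs : Sorting n τ N key B 1 s)
    (hL : (prefixList (s.arr 2) N).Perm (List.range N)) :
    Runs W S sortProgram (m * (1100 * N) + 10) s fun s' => (∃ P, Sorting n τ N key B P s') ∧
      (prefixList (s'.arr 2) N).Perm (List.range N) ∧
      (prefixList (s'.arr 2) N).Pairwise fun p q => key p ≤ key q := by
  have hW := hz.word
  have hnN := hz.le_sq
  have h2n := hz.two_le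
  have hBW : B + 1 ≤ W := (Nat.le_mul_of_pos_right _ (by omega)).trans hB
  unfold sortProgram
  refine Runs.whileLoop hW (C := 1000 * N + 7) (m := m) (fun j s => ∃ i, i + j = m ∧
    Sorting n τ N key B (n ^ i) s ∧ (prefixList (s.arr 2) N).Perm (List.range N) ∧
    (prefixList (s.arr 2) N).Pairwise fun p q => key p % n ^ i ≤ key q % n ^ i) ?_ ?_ ?_ ?_ ?_
  · rintro j s ⟨i, -, hs, -⟩
    simp [hs.var₅, hBW]
  · rintro j s ⟨i, hi, hs, hL, hsort⟩ hlt
    simp only [eval_var, eval_add, eval_lit, hs.var₅, hs.var₆] at hlt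
    have hpos : 0 < n ^ i := Nat.pow_pos (by omega)
    have him : i < m := by
      by_contra hge
      have := Nat.pow_le_pow_right (show 0 < n by omega) (not_lt.mp hge)
      omega
    have hle : n ^ i * n ≤ (B + 1) * n := Nat.mul_le_mul_right _ (by omega)
    refine Runs.seq (Runs.mono (runs_passProgram hz hpos hkey (by omega) hs hL) le_rfl ?_) le_rfl
    rintro s₁ ⟨hs₁, hpass⟩
    refine Runs.set hW (v := n ^ i * n) (by simp [hs₁.var₆, hs₁.var₀])
      (by simp [hs₁.var₆, hs₁.var₀]; omega) ?_
    refine ⟨j - 1, by omega, i + 1, by omega,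
      ⟨hs₁.toBase.setVar, by simp [hs₁.var₅], by simp [Nat.pow_succ], hs₁.empty₆, hs₁.empty₇,
        hs₁.empty₈⟩, ?_, ?_⟩
    · rw [AState.arr_setVar, hpass]
      exact (RadixSort.pass_perm fun p _ => Nat.mod_lt _ (by omega)).trans hL
    · rw [AState.arr_setVar, hpass, Nat.pow_succ]
      exact RadixSort.pass_sorted hpos hsort
  · refine ⟨0, by omega, by simpa using hs, hL, ?_⟩
    simp only [Nat.pow_zero, Nat.mod_one, le_refl]
    exact List.pairwise_of_forall fun _ _ => trivial
  · rintro j s ⟨i, -, hs, hL, hsort⟩ hle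
    simp only [eval_var, eval_add, eval_lit, hs.var₅, hs.var₆] at hle
    refine ⟨⟨_, hs⟩, hL, hsort.imp_of_mem fun {p q} hp hq hpq => ?_⟩
    have hp' := hkey p (List.mem_range.mp (hL.mem_iff.mp hp))
    have hq' := hkey q (List.mem_range.mp (hL.mem_iff.mp hq))
    rwa [Nat.mod_eq_of_lt (by omega), Nat.mod_eq_of_lt (by omega)] at hpq
  · have : m * (1000 * N + 7 + 2 + (2 + 1 + 1) + 1) ≤ m * (1100 * N) :=
      Nat.mul_le_mul_left _ (by omega)
    change m * (1000 * N + 7 + 2 + (2 + 1 + 1) + 1) + (2 + (2 + 1 + 1) + 1) ≤ _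
    omega

theorem runs_keysProgram (hz : Sizes n N S W) {a b : ℕ → ℕ} {D : ℕ}
    (hD : D = ∑ p ∈ Finset.range N, b p) (hkey : ∀ p < N, key p = a p * (D * D) / b p)
    (hBsum : B = ∑ p ∈ Finset.range N, key p) (hb : ∀ p < N, b p ≠ 0)
    (hDW : D * D ≤ W) (haW : ∀ p < N, a p * (D * D) ≤ W) (hBW : B ≤ W) {s : AState}
    (h0 : s.var 0 = n) (h1 : s.var 1 = τ) (hvar : ∀ x, 2 ≤ x → s.var x = 0)
    (hnum : ∀ p < N, s.arr 0 (2 * p) = a p) (hden : ∀ p < N, s.arr 0 (2 * p + 1) = b p)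
    (h6 : ∀ i < n, s.arr 6 i = 0) (h7 : ∀ i < n, s.arr 7 i = 0) (h8 : ∀ i < n, s.arr 8 i = 0) :
    Runs W S keysProgram (1000 * N) s fun s' => Sorting n τ N key B 1 s' ∧
      ∀ p < N, s'.arr 2 p = p := by
  have hW := hz.word
  have hnN := hz.le_sq
  have h2n := hz.two_le
  have hNS := hz.two_mul_le
  have hDD : D ≤ D * D := Nat.le_mul_self D
  have hpartial : ∀ (f : ℕ → ℕ) k, k < N →
      ∑ p ∈ Finset.range k, f p + f k ≤ ∑ p ∈ Finset.range N, f p := by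
    intro f k hk
    rw [← Finset.sum_range_succ]
    exact Finset.sum_le_sum_of_subset (Finset.range_subset_range.mpr hk)
  unfold keysProgram
  refine Runs.mono (T := 7 + ((N * (100 + 2 + 2 + 1) + 5) + (7 + (3 +
    ((N * (200 + 2 + 2 + 1) + 5) + 3))))) (Q := _) ?_ (by omega) fun _ h => h
  refine Runs.seq (Runs.set hW (v := N) (by simp [h0, hz.sq]) ?_ ?_) (T₁ := 7) le_rfl
  · simp only [ok_mul, ok_var, eval_var, h0, ← hz.sq]
    omega
  refine Runs.seq (Runs.mono (Runs.loop hW (C := 100) N (fun k t => t.arr = s.arr ∧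
    t.var 0 = n ∧ t.var 1 = τ ∧ t.var 2 = N ∧ t.var 5 = 0 ∧ t.var 7 = k ∧
    t.var 3 = ∑ p ∈ Finset.range k, b p) ?_ ?_ ?_ le_rfl) le_rfl ?_) le_rfl
  · rintro k t ⟨-, -, -, ht2, -, ht7, -⟩ hk
    simp [ht2, ht7]
  · rintro k t ⟨ht, ht0, ht1, ht2, ht5, ht7, ht3⟩ hk
    have hle := hpartial b k hk
    refine Runs.set_seq hW (v := ∑ p ∈ Finset.range (k + 1), b p) ?_ ?_ ?_
    · simp [ht, ht7, ht3, hden k hk, Finset.sum_range_succ]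
    · simp [ht, ht7, ht3, hden k hk]
      omega
    refine Runs.set hW (v := k + 1) (by simp [ht7]) (by simp [ht7]; omega) ?_
    simp [ht, ht0, ht1, ht2, ht5]
  · simp [h0, h1, hvar]
  rintro s₁ ⟨ht, ht0, ht1, ht2, ht5, -, ht3⟩
  rw [← hD] at ht3
  refine Runs.seq (Runs.set hW (v := D * D) (by simp [ht3]) (by simpa [ht3] using hDW) ?_)
    (T₁ := 7) le_rfl
  refine Runs.seq (Runs.set hW (v := 0) rfl (by simp) ?_) (T₁ := 3) le_rfl
  refine Runs.seq (Runs.mono (Runs.loop hW (C := 200) N (fun k t => t.arr 0 = s.arr 0 ∧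
    t.arr 6 = s.arr 6 ∧ t.arr 7 = s.arr 7 ∧ t.arr 8 = s.arr 8 ∧
    t.var 0 = n ∧ t.var 1 = τ ∧ t.var 2 = N ∧ t.var 4 = D * D ∧ t.var 7 = k ∧
    t.var 5 = ∑ p ∈ Finset.range k, key p ∧ (∀ p < k, t.arr 1 p = key p) ∧
    ∀ p < k, t.arr 2 p = p) ?_ ?_ ?_ le_rfl) le_rfl ?_) le_rfl
  · rintro k t ⟨-, -, -, -, -, -, ht2, -, ht7, -⟩ hk
    simp [ht2, ht7]
  · rintro k t ⟨hta0, hta6, hta7, hta8, ht0, ht1, ht2, ht4, ht7, ht5, hta1, hta2⟩ hk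
    have hle := hpartial key k hk
    have hb' := hb k hk
    have ha' := haW k hk
    have hdiv : a k * (D * D) / b k ≤ a k * (D * D) := Nat.div_le_self _ _
    refine Runs.put_seq hW (j := k) (v := key k) (by simp [ht7]) ?_ (by simp) ?_ (by omega) ?_
    · simp [ht7, hta0, hnum k hk, hden k hk, ht4, hkey k hk]
    · simp [ht7, hta0, hnum k hk, hden k hk, ht4]
      omega
    refine Runs.set_seq hW (v := ∑ p ∈ Finset.range (k + 1), key p) ?_ ?_ ?_
    · simp [ht7, ht5, Finset.sum_range_succ]
    · simp [ht7, ht5]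
      omega
    refine Runs.put_seq hW (j := k) (v := k) (by simp [ht7]) (by simp [ht7]) (by simp) (by simp)
      (by omega) ?_
    refine Runs.set hW (v := k + 1) (by simp [ht7]) (by simp [ht7]; omega) ?_
    refine ⟨by simp [hta0], by simp [hta6], by simp [hta7], by simp [hta8], by simp [ht0],
      by simp [ht1], by simp [ht2], by simp [ht4], by simp, by simp, fun p hp => ?_,
      fun p hp => ?_⟩
    · simp only [AState.arr_setVar, AState.arr_setArr]
      by_cases hpk : p = k
      · simp [hpk]
      · simp [hpk, hta1 p (by omega)]
    · simp only [AState.arr_setVar, AState.arr_setArr]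
      by_cases hpk : p = k
      · simp [hpk]
      · simp [hpk, hta2 p (by omega)]
  · simp [ht, ht0, ht1, ht2, ht5]
  rintro s₂ ⟨-, hta6, hta7, hta8, ht0, ht1, ht2, -, -, ht5, hta1, hta2⟩
  refine Runs.set hW (v := 1) rfl (by simp) ⟨⟨⟨by simp [ht0], by simp [ht1], by simp [ht2],
    by simpa using hta1⟩, by simp [ht5, hBsum], by simp, ?_, ?_, ?_⟩, by simpa using hta2⟩
  · simpa [hta6] using h6
  · simpa [hta7] using h7
  · simpa [hta8] using h8

/-- The pairs that belong to the list of `u`: the first component is `u`, and the two components are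
adjacent. -/
def selected (n : ℕ) (key : ℕ → ℕ) (u p : ℕ) : Bool :=
  decide (p / n = u) && decide (0 < key p + key (p % n * n + p / n))

theorem runs_listsProgram (hz : Sizes n N S W) (hkey : ∀ p < N, 2 * key p ≤ W) {s : AState}
    (hs : Sorting n τ N key B P s) (hL : (prefixList (s.arr 2) N).Perm (List.range N)) :
    Runs W S listsProgram (1000 * N) s fun s' => Base n τ N key s' ∧
      (∀ i < n, s'.arr 7 i = 0) ∧ (∀ i < n, s'.arr 8 i = 0) ∧
      ∀ u < n, prefixList (fun j => s'.arr 5 (u * N + j)) (s'.arr 6 u) =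
        ((prefixList (s.arr 2) N).reverse.filter (selected n key u)).map (· % n) := by
  have hW := hz.word
  have hnN := hz.le_sq
  have h2n := hz.two_le
  have hNS := hz.two_mul_le
  set f := s.arr 2 with hf
  set g : ℕ → ℕ := fun i => f (N - 1 - i) with hg
  have hgN : ∀ k < N, g k < N := by
    intro k hk
    have : g k ∈ prefixList f N := List.mem_map_of_mem (List.mem_range.mpr (by omega))
    exact List.mem_range.mp (hL.mem_iff.mp this)
  have hrev : (prefixList f N).reverse = prefixList g N := by
    refine List.ext_getElem (by simp) fun i h1 h2 => ?_
    simp [hg]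
  unfold listsProgram
  refine Runs.mono (T := 3 + (N * (300 + 2 + 2 + 1) + 5)) (Q := _) ?_ (by omega) fun _ h => h
  refine Runs.seq (Runs.set hW (v := 0) rfl (by simp) ?_) (T₁ := 3) le_rfl
  refine Runs.mono (Runs.loop hW (C := 300) N (fun k t => Base n τ N key t ∧ t.arr 2 = f ∧
    t.var 7 = k ∧ (∀ i < n, t.arr 7 i = 0) ∧ (∀ i < n, t.arr 8 i = 0) ∧
    ∀ u < n, prefixList (fun j => t.arr 5 (u * N + j)) (t.arr 6 u) =
      ((prefixList g k).filter (selected n key u)).map (· % n)) ?_ ?_ ?_ le_rfl) le_rfl ?_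
  · rintro k t ⟨ht, -, ht7, -⟩ hk
    simp [ht.var₂, ht7]
  · rintro k t ⟨ht, ht2, ht7, hta7, hta8, hl⟩ hk
    have hgk := hgN k hk
    have hgk' := hkey _ hgk
    have hmod : g k - g k / n * n = g k % n := by
      have := Nat.div_add_mod (g k) n
      rw [Nat.mul_comm] at this
      omega
    have hmodn : g k % n < n := Nat.mod_lt _ (by omega)
    have hdivn : g k / n < n := by
      rw [Nat.div_lt_iff_lt_mul (by omega), ← hz.sq]
      exact hgk
    have hdivle : g k / n * n ≤ g k := Nat.div_mul_le_self _ _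
    have hq := hz.pair_lt hmodn hdivn
    have hq' := hkey _ hq
    have hmuln : g k % n * n ≤ N := (Nat.le_add_right _ _).trans hq.le
    refine Runs.set_seq hW (v := g k) (by simp [ht.var₂, ht7, ht2, hg])
      (by simp [ht.var₂, ht7]; omega) ?_
    refine Runs.set_seq hW (v := g k / n) (by simp [ht.var₀]) (by simp [ht.var₀]; omega) ?_
    refine Runs.set_seq hW (v := g k % n) (by simp [ht.var₀, hmod]) (by simp [ht.var₀]; omega) ?_
    have hbase := ((ht.setVar (x := 8) (v := g k)).setVar (x := 12) (v := g k / n)).setVar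
      (x := 15) (v := g k % n)
    refine Runs.ite hW (by simp) ?_ (fun hlt => ?_) (fun hle => ?_)
    · simp [ht.var₀, ht.keys _ hq, ht.keys _ hgk]
      omega
    · simp [ht.var₀, ht.keys _ hq, ht.keys _ hgk, -add_pos_iff] at hlt
      obtain ⟨hcnt, hstep⟩ := bucket_step hk hl hdivn fun d _ => by
        simp only [selected, Bool.and_eq_true, decide_eq_true_eq, hlt, and_true]
        exact eq_comm
      have haddr := hz.addr_lt hdivn hcnt
      refine Runs.put_seq hW (j := g k / n * N + t.arr 6 (g k / n)) (v := g k % n)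
        (by simp [ht.var₂]) (by simp) (by simp [ht.var₂]; omega) (by simp) haddr ?_
      refine Runs.put_seq hW (j := g k / n) (v := t.arr 6 (g k / n) + 1) (by simp)
        (by simp) (by simp) (by simp; omega) (by omega) ?_
      refine Runs.set hW (v := k + 1) (by simp [ht7]) (by simp [ht7]; omega) ?_
      refine ⟨hbase.setArr.setArr.setVar, by simp [ht2], by simp, by simpa using hta7,
        by simpa using hta8, fun u hu => ?_⟩
      simpa using hstep u hu
    · simp [ht.var₀, ht.keys _ hq, ht.keys _ hgk, -add_eq_zero, -Nat.add_eq_zero_iff] at hle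
      refine Runs.set hW (v := k + 1) (by simp [ht7]) (by simp [ht7]; omega) ?_
      refine ⟨hbase.setVar, by simp [ht2], by simp, by simpa using hta7,
        by simpa using hta8, fun u hu => ?_⟩
      rw [prefixList_succ, List.filter_append, List.filter_singleton]
      simpa [selected, hle] using hl u hu
  · refine ⟨hs.toBase.setVar, rfl, by simp, hs.empty₇, hs.empty₈, fun u hu => ?_⟩
    simp [hs.empty₆ u hu, prefixList]
  · rintro t ⟨ht, -, -, hta7, hta8, hl⟩
    rw [hrev]
    exact ⟨ht, hta7, hta8, hl⟩

/-- Adjacency in terms of the keys. -/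
def KeyAdj (n : ℕ) (key : ℕ → ℕ) (u v : ℕ) : Prop := 0 < key (u * n + v) + key (v * n + u)

/-- The lists that are read off from the sorted list of all pairs are preference lists. -/
theorem isPrefTable_of_lists (hn : 0 < n) {L : List ℕ} (hperm : L.Perm (List.range (n * n)))
    (hsort : L.Pairwise fun p q => key p ≤ key q) {deg : ℕ → ℕ} {pref : ℕ → ℕ → ℕ}
    (h : ∀ u < n, prefixList (pref u) (deg u) =
      (L.reverse.filter (selected n key u)).map (· % n)) :
    DeferredAcceptance.IsPrefTable n (KeyAdj n key) (fun u v => key (u * n + v)) deg pref := by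
  have hmem : ∀ u < n, ∀ v, v ∈ prefixList (pref u) (deg u) ↔ v < n ∧ KeyAdj n key u v := by
    intro u hu v
    rw [h u hu, List.mem_map]
    constructor
    · rintro ⟨p, hp, rfl⟩
      simp only [List.mem_filter, selected, Bool.and_eq_true, decide_eq_true_eq] at hp
      obtain ⟨-, rfl, hp⟩ := hp
      refine ⟨Nat.mod_lt _ hn, ?_⟩
      rwa [KeyAdj, Nat.div_add_mod']
    · rintro ⟨hv, hadj⟩
      have hdiv : (u * n + v) / n = u := by
        rw [Nat.mul_comm, Nat.mul_add_div hn, Nat.div_eq_of_lt hv, Nat.add_zero]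
      have hmod : (u * n + v) % n = v := by
        rw [Nat.mul_comm, Nat.mul_add_mod, Nat.mod_eq_of_lt hv]
      refine ⟨u * n + v, ?_, hmod⟩
      simp only [List.mem_filter, List.mem_reverse, selected, Bool.and_eq_true,
        decide_eq_true_eq, hdiv, hmod, true_and]
      refine ⟨hperm.mem_iff.mpr (List.mem_range.mpr ?_), hadj⟩
      have : (u + 1) * n ≤ n * n := Nat.mul_le_mul_right _ hu
      rw [Nat.succ_mul] at this
      omega
  have hmem' : ∀ u < n, ∀ k < deg u, pref u k < n ∧ KeyAdj n key u (pref u k) := fun u hu k hk =>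
    (hmem u hu _).mp (List.mem_map_of_mem (List.mem_range.mpr hk))
  refine ⟨fun u hu => ?_, fun u hu k hk => (hmem' u hu k hk).1,
    fun u hu k hk => (hmem' u hu k hk).2, fun u hu v hv hadj => ?_, fun u hu j k hjk hk => ?_⟩
  · have hnodup : (prefixList (pref u) (deg u)).Nodup := by
      rw [h u hu]
      refine List.Nodup.map_on (fun p hp q hq hpq => ?_)
        (((List.nodup_reverse.mpr (hperm.nodup_iff.mpr List.nodup_range))).filter _)
      simp only [List.mem_filter, selected, Bool.and_eq_true, decide_eq_true_eq] at hp hq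
      rw [← Nat.div_add_mod p n, ← Nat.div_add_mod q n, hp.2.1, hq.2.1, hpq]
    have hsub : prefixList (pref u) (deg u) ⊆ List.range n := fun v hv =>
      List.mem_range.mpr ((hmem u hu v).mp hv).1
    simpa using (hnodup.subperm hsub).length_le
  · obtain ⟨k, hk, hkv⟩ := List.mem_map.mp ((hmem u hu v).mpr ⟨hv, hadj⟩)
    exact ⟨k, List.mem_range.mp hk, hkv⟩
  · have hpw : (prefixList (pref u) (deg u)).Pairwise fun v w =>
        key (u * n + w) ≤ key (u * n + v) := by
      rw [h u hu, List.pairwise_map]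
      have hrev : L.reverse.Pairwise fun p q => key q ≤ key p := List.pairwise_reverse.mpr hsort
      refine (hrev.filter _).imp_of_mem fun {p q} hp hq hpq => ?_
      simp only [List.mem_filter, selected, Bool.and_eq_true, decide_eq_true_eq] at hp hq
      rw [← hp.2.1, Nat.div_add_mod', hp.2.1, ← hq.2.1, Nat.div_add_mod']
      exact hpq
    rw [List.pairwise_map] at hpw
    rcases Nat.eq_or_lt_of_le hjk with rfl | hlt
    · exact le_rfl
    · have := List.pairwise_iff_getElem.mp hpw j k (by simp; omega) (by simpa using hk) hlt
      simpa using this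

open DeferredAcceptance in
theorem runs_acceptanceProgram (hz : Sizes n N S W) {s : AState} {Sat Zero : ℕ → ℕ → Prop}
    (hp : IsPrefTable n (KeyAdj n key) (fun u v => key (u * n + v)) (s.arr 6)
      fun u j => s.arr 5 (u * N + j))
    (hw : IsWitness n (KeyAdj n key) (fun u v => key (u * n + v)) Sat Zero)
    (hs : Base n τ N key s) (h7 : ∀ i < n, s.arr 7 i = 0) (h8 : ∀ i < n, s.arr 8 i = 0) :
    Runs W S acceptanceProgram (1000 * N) s fun s' => s'.var 1 = τ ∧ ∃ ptr hold cur,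
      Inv n (KeyAdj n key) (s.arr 6) (fun u j => s.arr 5 (u * N + j)) Sat Zero ptr hold n cur
        (s'.var 14) := by
  have hW := hz.word
  have hnN := hz.le_sq
  have h2n := hz.two_le
  have hNS := hz.two_mul_le
  set deg := s.arr 6 with hdeg
  set pref : ℕ → ℕ → ℕ := fun u j => s.arr 5 (u * N + j) with hpref
  -- every iteration makes a proposal or lets a new agent enter
  have hbound : ∀ {ptr hold u cur h}, Inv n (KeyAdj n key) deg pref Sat Zero ptr hold u cur h →
      ∑ v ∈ Finset.range n, ptr v + u ≤ N + n := by
    intro ptr hold u cur h hi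
    have h1 : ∑ v ∈ Finset.range n, ptr v ≤ ∑ v ∈ Finset.range n, n :=
      Finset.sum_le_sum fun v hv => (hi.ptr_le v (Finset.mem_range.mp hv)).trans
        (hp.deg_le v (Finset.mem_range.mp hv))
    rw [Finset.sum_const, Finset.card_range, smul_eq_mul, ← hz.sq] at h1
    have := hi.u_le
    omega
  have hupdate : ∀ (ptr : ℕ → ℕ) (c : ℕ), c < n →
      ∑ v ∈ Finset.range n, Function.update ptr c (ptr c + 1) v =
        ∑ v ∈ Finset.range n, ptr v + 1 := by
    intro ptr c hc
    rw [Finset.sum_update_of_mem (Finset.mem_range.mpr hc),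
      Finset.sum_eq_add_sum_sdiff_singleton_of_mem (Finset.mem_range.mpr hc) ptr]
    omega
  unfold acceptanceProgram
  refine Runs.mono (T := 3 + (3 + (3 + ((N + n) * (400 + 2 + 2 + 1) + 5)))) (Q := _) ?_
    (by omega) fun _ h => h
  refine Runs.seq (Runs.set hW (v := 0) rfl (by simp) ?_) (T₁ := 3) le_rfl
  refine Runs.seq (Runs.set hW (v := 0) rfl (by simp) ?_) (T₁ := 3) le_rfl
  refine Runs.seq (Runs.set hW (v := 0) rfl (by simp) ?_) (T₁ := 3) le_rfl
  refine Runs.whileLoop hW (C := 400) (m := N + n) (fun m t => Base n τ N key t ∧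
    t.arr 6 = deg ∧ t.arr 5 = s.arr 5 ∧
    m + (∑ v ∈ Finset.range n, t.arr 7 v + t.var 12) = N + n ∧
    Inv n (KeyAdj n key) deg pref Sat Zero (t.arr 7) (t.arr 8) (t.var 12) (t.var 13) (t.var 14))
    ?_ ?_ ?_ ?_ le_rfl
  · rintro m t -
    simp
  · rintro m t ⟨ht, ht6, ht5, hm, hi⟩ hu
    simp only [eval_var, ht.var₀] at hu
    have hstep : ∀ {ptr hold : ℕ → ℕ} {u cur h : ℕ},
        Inv n (KeyAdj n key) deg pref Sat Zero ptr hold u cur h →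
        ∑ v ∈ Finset.range n, t.arr 7 v + t.var 12 < ∑ v ∈ Finset.range n, ptr v + u →
        ∃ m' < m, m' + (∑ v ∈ Finset.range n, ptr v + u) = N + n := by
      intro ptr hold u cur h hi' hlt
      have := hbound hi'
      exact ⟨N + n - (∑ v ∈ Finset.range n, ptr v + u), by omega, by omega⟩
    have hc := hi.cur_lt hu
    have hsum := hupdate (t.arr 7) _ hc
    have hcard : t.var 14 ≤ n := by
      rw [hi.card]
      exact (Finset.card_filter_le _ _).trans (Finset.card_range n).le
    generalize hcur : t.var 13 = c at hi hc hsum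
    have hdegc := hp.deg_le c hc
    refine Runs.ite hW (by simp [hcur]; omega) (by simp [hcur]; omega) (fun hd => ?_) (fun hd => ?_)
    · simp only [eval_get, eval_var, hcur, ht6] at hd
      have hxn := hp.lt c hc _ hd
      generalize hx : pref c (t.arr 7 c) = x at hxn
      have haddr := hz.addr_lt hc (show t.arr 7 c < N by omega)
      have hx' : t.arr 5 (c * N + t.arr 7 c) = x := by rw [ht5, ← hx]
      refine Runs.set_seq hW (v := x) (by simp [hcur, ht.var₂, hx'])
        (by simp [hcur, ht.var₂]; omega) ?_
      refine Runs.put_seq hW (j := c) (v := t.arr 7 c + 1) (by simp [hcur]) (by simp [hcur])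
        (by simp) (by simp [hcur]; omega) (by omega) ?_
      refine Runs.ite hW (by simp; omega) (by simp) (fun h0 => ?_) (fun h0 => ?_)
      · simp at h0
        have hi' := hi.accept_empty hp hw hu hd hx h0
        refine Runs.put_seq hW (j := x) (v := c + 1) (by simp) (by simp [hcur])
          (by simp) (by simp [hcur]; omega) (by omega) ?_
        refine Runs.set_seq hW (v := t.var 14 + 1) (by simp) (by simp; omega) ?_
        refine Runs.set_seq hW (v := t.var 12 + 1) (by simp) (by simp; omega) ?_
        refine Runs.set hW (v := t.var 12 + 1) (by simp) (by simp) ?_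
        obtain ⟨m', hm', hm''⟩ := hstep hi' (by omega)
        exact ⟨m', hm', ht.setVar.setArr.setArr.setVar.setVar.setVar, by simp [ht6], by simp [ht5],
          by simpa using hm'', by simpa using hi'⟩
      · simp at h0
        obtain ⟨y, hy⟩ : ∃ y, t.arr 8 x = y + 1 := ⟨t.arr 8 x - 1, by omega⟩
        have hyn : y < n := by
          have := hi.hold_le x hxn
          omega
        have hxc := hz.pair_lt hxn hc
        have hxy := hz.pair_lt hxn hyn
        have hxn' : x * n ≤ N := (Nat.le_add_right _ _).trans hxc.le
        refine Runs.set_seq hW (v := y) (by simp [hy]) (by simp [hy]; omega) ?_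
        refine Runs.ite hW (by simp [ht.var₀]; omega) (by simp [ht.var₀, hcur]; omega)
          (fun hlt => ?_) (fun hle => ?_)
        · simp [ht.var₀, hcur, ht.keys _ hxc, ht.keys _ hxy] at hlt
          have hi' := hi.accept_swap hp hw hu hd hx hy hlt
          refine Runs.put_seq hW (j := x) (v := c + 1) (by simp) (by simp [hcur])
            (by simp) (by simp [hcur]; omega) (by omega) ?_
          refine Runs.set hW (v := y) (by simp) (by simp) ?_
          obtain ⟨m', hm', hm''⟩ := hstep hi' (by omega)
          exact ⟨m', hm', ht.setVar.setArr.setVar.setArr.setVar, by simp [ht6], by simp [ht5],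
            by simpa using hm'', by simpa using hi'⟩
        · simp [ht.var₀, hcur, ht.keys _ hxc, ht.keys _ hxy] at hle
          have hi' := hi.reject hp hw hu hd hx hy hle
          refine Runs.set hW (v := 0) rfl (by simp) ?_
          obtain ⟨m', hm', hm''⟩ := hstep hi' (by omega)
          exact ⟨m', hm', ht.setVar.setArr.setVar.setVar, by simp [ht6], by simp [ht5],
            by simpa using hm'', by simpa [hcur] using hi'⟩
    · simp only [eval_get, eval_var, hcur, ht6] at hd
      have hi' := hi.exhausted hu hd
      refine Runs.set_seq hW (v := t.var 12 + 1) (by simp) (by simp; omega) ?_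
      refine Runs.set hW (v := t.var 12 + 1) (by simp) (by simp) ?_
      obtain ⟨m', hm', hm''⟩ := hstep hi' (by omega)
      exact ⟨m', hm', ht.setVar.setVar, by simp [ht6], by simp [ht5],
        by simpa using hm'', by simpa using hi'⟩
  · refine ⟨hs.setVar.setVar.setVar, rfl, rfl, ?_, ?_⟩
    · simpa using h7
    · simpa using Inv.init (by omega) h7 h8
  · rintro m t ⟨ht, -, -, -, hi⟩ hle
    simp only [eval_var, ht.var₀] at hle
    have : t.var 12 = n := le_antisymm hi.u_le hle
    rw [this] at hi
    exact ⟨ht.var₁, _, _, _, hi⟩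

/-! ### Correctness of the decision program -/

/-- Two different fractions with denominators up to `D` differ by at least `1 / D ^ 2`, and so their
multiples by `D ^ 2` have different integer parts. -/
theorem key_lt_key {a b c d D : ℕ} (hb : 0 < b) (hbD : b ≤ D) (hd : 0 < d) (hdD : d ≤ D)
    (h : a * d < c * b) : a * (D * D) / b < c * (D * D) / d := by
  rw [Nat.lt_iff_add_one_le, Nat.le_div_iff_mul_le hd]
  have h1 : a * (D * D) / b * b ≤ a * (D * D) := Nat.div_mul_le_self _ _
  generalize a * (D * D) / b = q at h1
  have h2 : b * d ≤ D * D := Nat.mul_le_mul hbD hdD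
  refine Nat.le_of_mul_le_mul_right ?_ hb
  calc (q + 1) * d * b = q * b * d + b * d := by ring
    _ ≤ a * (D * D) * d + D * D := Nat.add_le_add (Nat.mul_le_mul_right _ h1) h2
    _ = (a * d + 1) * (D * D) := by ring
    _ ≤ c * b * (D * D) := Nat.mul_le_mul_right _ h
    _ = c * (D * D) * b := by ring

theorem key_le_key {a b c d D : ℕ} (hb : 0 < b) (hd : 0 < d) (h : c * b ≤ a * d) :
    c * (D * D) / d ≤ a * (D * D) / b := by
  rw [Nat.le_div_iff_mul_le hb]
  have h1 : c * (D * D) / d * d ≤ c * (D * D) := Nat.div_mul_le_self _ _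
  generalize c * (D * D) / d = q at h1
  refine Nat.le_of_mul_le_mul_right ?_ hd
  calc q * b * d = q * d * b := by ring
    _ ≤ c * (D * D) * b := Nat.mul_le_mul_right _ h1
    _ = c * b * (D * D) := by ring
    _ ≤ a * d * (D * D) := Nat.mul_le_mul_right _ h
    _ = a * (D * D) * d := by ring

/-- The keys represent the preferences. -/
structure KeysRepresent (I : PrefGraph (Fin n)) (key : ℕ → ℕ) : Prop where
  lt_iff : ∀ u v w : Fin n, I.sat u v < I.sat u w ↔ key (u * n + v) < key (u * n + w)
  pos_iff : ∀ u v : Fin n, 0 < I.sat u v ↔ 0 < key (u * n + v)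

theorem keysRepresent {I : PrefGraph (Fin n)} {num den : Fin n → Fin n → ℕ} {D : ℕ}
    (hsat : ∀ u v, 0 < den u v ∧ I.sat u v = (num u v : ℝ) / (den u v : ℝ))
    (hD : ∀ u v, den u v ≤ D)
    (hkey : ∀ u v : Fin n, key (u * n + v) = num u v * (D * D) / den u v) :
    KeysRepresent I key where
  lt_iff u v w := by
    have h1 := (hsat u v).1
    have h2 := (hsat u w).1
    have h1' : (0 : ℝ) < den u v := Nat.cast_pos.mpr h1
    have h2' : (0 : ℝ) < den u w := Nat.cast_pos.mpr h2
    rw [(hsat u v).2, (hsat u w).2, div_lt_div_iff₀ h1' h2', hkey, hkey]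
    norm_cast
    refine ⟨fun h => key_lt_key h1 (hD u v) h2 (hD u w) h, fun h => ?_⟩
    by_contra hle
    exact absurd h (not_lt.mpr (key_le_key h1 h2 (not_lt.mp hle)))
  pos_iff u v := by
    have h1 := (hsat u v).1
    have h1' : (0 : ℝ) < den u v := Nat.cast_pos.mpr h1
    rw [(hsat u v).2, hkey, lt_div_iff₀ h1', zero_mul, Nat.cast_pos]
    refine ⟨fun h => ?_, fun h => ?_⟩
    · have := key_lt_key (a := 0) (b := 1) (c := num u v) one_pos (h1.trans_le (hD u v)) h1 (hD u v)
        (by omega)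
      omega
    · rcases Nat.eq_zero_or_pos (num u v) with h0 | h0
      · simp [h0] at h
      · exact h0

theorem KeysRepresent.keyAdj_iff {I : PrefGraph (Fin n)} (h : KeysRepresent I key) (u v : Fin n) :
    KeyAdj n key u v ↔ I.G.Adj u v := by
  rw [I.adj_iff, h.pos_iff, h.pos_iff, KeyAdj]
  omega

open DeferredAcceptance in
theorem KeysRepresent.isWitness {I : PrefGraph (Fin n)} (h : KeysRepresent I key) (hI : I.Strict)
    {M : Fin n → Fin n → ℝ} (hM : I.IsOSM M) :
    IsWitness n (KeyAdj n key) (fun u v => key (u * n + v))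
      (fun x y => ∃ (hx : x < n) (hy : y < n), I.loadGe M ⟨x, hx⟩ ⟨y, hy⟩ = 1)
      (fun y x => ∃ (hy : y < n) (hx : x < n), M ⟨y, hy⟩ ⟨x, hx⟩ = 0) where
  adj_symm x y hxy := by
    unfold KeyAdj at hxy ⊢
    omega
  strict v hv x hx y hy hvx hvy hxy heq := by
    have h1 := (h.keyAdj_iff ⟨v, hv⟩ ⟨x, hx⟩).mp hvx
    have h2 := (h.keyAdj_iff ⟨v, hv⟩ ⟨y, hy⟩).mp hvy
    rcases lt_or_gt_of_ne (hI _ _ _ h1 h2 (by simpa using hxy)) with h3 | h3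
    · exact ((h.lt_iff _ _ _).mp h3).ne heq
    · exact ((h.lt_iff _ _ _).mp h3).ne heq.symm
  sat y hy x hx hyx hz := by
    refine ⟨hx, hy, hM.loadGe_eq_one_of_forall_better hI ((h.keyAdj_iff ⟨y, hy⟩ ⟨x, hx⟩).mp hyx)
      fun z hz1 hz2 => ?_⟩
    obtain ⟨_, _, h0⟩ := hz z z.2 ((h.keyAdj_iff ⟨y, hy⟩ z).mpr hz1) ((h.lt_iff ⟨y, hy⟩ _ z).mp hz2)
    exact h0
  zero x hx y hy z hz _ _ hsat hlt := by
    obtain ⟨_, _, h1⟩ := hsat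
    refine ⟨hz, hx, ?_⟩
    rw [hM.1.symm]
    exact hM.1.eq_zero_of_sat_lt h1 ((h.lt_iff ⟨x, hx⟩ ⟨z, hz⟩ ⟨y, hy⟩).mpr hlt)

open DeferredAcceptance in
/-- The number of holders at the end of deferred acceptance is the number of fully matched agents of
any ordinally stable matching. -/
theorem KeysRepresent.numFully_eq {I : PrefGraph (Fin n)} (h : KeysRepresent I key)
    {M : Fin n → Fin n → ℝ} (hM : I.IsOSM M) {deg : ℕ → ℕ} {pref : ℕ → ℕ → ℕ} {ptr hold : ℕ → ℕ}
    {cur c : ℕ} (hp : IsPrefTable n (KeyAdj n key) (fun u v => key (u * n + v)) deg pref)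
    (hi : Inv n (KeyAdj n key) deg pref
      (fun x y => ∃ (hx : x < n) (hy : y < n), I.loadGe M ⟨x, hx⟩ ⟨y, hy⟩ = 1)
      (fun y x => ∃ (hy : y < n) (hx : x < n), M ⟨y, hy⟩ ⟨x, hx⟩ = 0) ptr hold n cur c) :
    c = I.numFully M := by
  classical
  rw [hi.card_eq hp (fun v => ∃ hv : v < n, I.FullyMatched M ⟨v, hv⟩)]
  · rw [PrefGraph.numFully, ← Set.ncard_image_of_injective _ Fin.val_injective,
      ← Set.ncard_coe_finset]
    congr 1
    ext v
    simp only [Finset.coe_filter, Finset.mem_range, Set.mem_ofPred_eq, Set.mem_image]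
    constructor
    · rintro ⟨hv, _, hf⟩
      exact ⟨⟨v, hv⟩, hf, rfl⟩
    · rintro ⟨w, hw, rfl⟩
      exact ⟨w.2, w.2, hw⟩
  · rintro x hx y hy ⟨_, _, h1⟩
    exact ⟨hx, le_antisymm (hM.1.load_le _) (h1.ge.trans (hM.1.loadGe_le_load _ _))⟩
  · rintro v hv hz ⟨_, hf⟩
    have h0 : I.load M ⟨v, hv⟩ = 0 := by
      rw [hM.1.load_eq]
      refine Finset.sum_eq_zero fun x _ => ?_
      by_cases hadj : I.G.Adj ⟨v, hv⟩ x
      · obtain ⟨_, _, h1⟩ := hz x x.2 ((h.keyAdj_iff ⟨v, hv⟩ x).mpr hadj)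
        exact h1
      · exact hM.1.support _ _ hadj
    rw [PrefGraph.FullyMatched, h0] at hf
    exact zero_ne_one hf

theorem entry_of_lt (A : Fin n → Fin n → ℕ) {i j : ℕ} (hi : i < n) (hj : j < n) :
    entry A i j = A ⟨i, hi⟩ ⟨j, hj⟩ := by
  rw [entry, dif_pos ⟨hi, hj⟩]

theorem entry_le {A : Fin n → Fin n → ℕ} {M : ℕ} (hA : ∀ u v, A u v ≤ M) (i j : ℕ) :
    entry A i j ≤ M := by
  unfold entry
  split_ifs
  · exact hA _ _
  · exact Nat.zero_le _

theorem inputState_mem_of_le (τ : ℕ) (num den : Fin n → Fin n → ℕ) {i : ℕ} (hn : 0 < n)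
    (hi : 2 * (n * n) ≤ i) : (inputState n τ num den).mem i = 0 := by
  have h : ¬ i / 2 / n < n := by
    rw [not_lt, Nat.le_div_iff_mul_le hn, Nat.le_div_iff_mul_le two_pos]
    omega
  simp only [inputState, entry]
  split_ifs <;> simp_all

/-- As all ordinally stable matchings have equally many fully matched agents, it suffices to count
them for one. -/
theorem maxFullProgram_spec {c τ : ℕ} {num den : Fin n → Fin n → ℕ} {I : PrefGraph (Fin n)}
    (hn : 0 < n) (hI : I.Strict)
    (hsat : ∀ u v, 0 < den u v ∧ I.sat u v = (num u v : ℝ) / (den u v : ℝ))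
    (hle : ∀ u v, num u v ≤ n ^ c ∧ den u v ≤ n ^ c) (hτ : τ ≤ n ^ c) :
    ∃ (t : ℕ) (s : State),
      Exec (n ^ (20000 * (c + 1))) maxFullProgram (inputState n τ num den) t s ∧
      t ≤ 20000 * (c + 1) * n ^ 2 ∧ (s.reg 0 = 1 ↔ I.MaxFullOSM τ) := by
  -- there is an edge, and so there are two agents
  have h2n : 2 ≤ n := by
    obtain ⟨w, hw⟩ := I.no_isolated ⟨0, hn⟩
    have := hw.ne
    rw [Ne, Fin.ext_iff] at this
    have := w.2
    simp only at *
    omega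
  obtain ⟨π, hπ⟩ := PrefGraph.exists_isStablePartition hI
  have hM := hπ.isOSM
  generalize partitionMatching π = M at hM
  have hmax : I.MaxFullOSM τ ↔ τ ≤ I.numFully M :=
    ⟨fun ⟨M', hM', h⟩ => h.trans (hM'.numFully_eq hI hM).le, fun h => ⟨M, hM, h⟩⟩
  set N := n * n with hN
  set S := n * N with hS
  set W := n ^ (20000 * (c + 1)) with hWdef
  have hpow : ∀ {i j : ℕ}, i ≤ j → n ^ i ≤ n ^ j := fun h => Nat.pow_le_pow_right hn h
  have hNpow : N = n ^ 2 := by rw [hN, sq]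
  have hSpow : S = n ^ 3 := by rw [hS, hN, pow_succ, sq, Nat.mul_comm]
  have hWbig : n ^ (3 * c + 9) ≤ W := hpow (by omega)
  have hmul2 : ∀ i, 2 * n ^ i ≤ n ^ (i + 1) := fun i => by
    rw [pow_succ, mul_comm]
    exact Nat.mul_le_mul_left _ h2n
  have hz : Sizes n N S W := by
    refine ⟨h2n, rfl, rfl, ?_⟩
    have h3 := hmul2 3
    have h4 := hmul2 4
    have h5 := hmul2 5
    have h6 := hmul2 6
    have h7 := hmul2 7
    have h8 : n ^ (7 + 1) ≤ n ^ (3 * c + 9) := hpow (by omega)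
    have h9 : n ^ 0 ≤ n ^ 3 := hpow (by omega)
    rw [pow_zero] at h9
    have h10 := hmul2 8
    have h11 : n ^ (8 + 1) ≤ n ^ (3 * c + 9) := hpow (by omega)
    norm_num at h3 h4 h5 h6 h7 h8 h10 h11
    omega
  have hNS := hz.two_mul_le
  have hnN := hz.le_sq
  -- the keys
  set a : ℕ → ℕ := fun p => entry num (p / n) (p % n) with ha
  set b : ℕ → ℕ := fun p => entry den (p / n) (p % n) with hb
  set D := ∑ p ∈ Finset.range N, b p with hD
  set key : ℕ → ℕ := fun p => a p * (D * D) / b p with hkey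
  set B := ∑ p ∈ Finset.range N, key p with hB
  have hdiv : ∀ p < N, p / n < n := fun p hp => by rwa [Nat.div_lt_iff_lt_mul hn]
  have hmod : ∀ p, p % n < n := fun p => Nat.mod_lt _ hn
  have hb0 : ∀ p < N, b p ≠ 0 := fun p hp => by
    rw [hb]
    simp only
    rw [entry_of_lt den (hdiv p hp) (hmod p)]
    exact (hsat _ _).1.ne'
  have hale : ∀ p, a p ≤ n ^ c := fun p => entry_le (fun u v => (hle u v).1) _ _
  have hble : ∀ p, b p ≤ n ^ c := fun p => entry_le (fun u v => (hle u v).2) _ _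
  have hsumle : ∀ (f : ℕ → ℕ) m, (∀ p < N, f p ≤ n ^ m) →
      ∑ p ∈ Finset.range N, f p ≤ n ^ (m + 2) := by
    intro f m hf
    have := Finset.sum_le_card_nsmul (Finset.range N) f (n ^ m)
      fun p hp => hf p (Finset.mem_range.mp hp)
    rw [Finset.card_range, smul_eq_mul] at this
    exact this.trans (le_of_eq (by rw [hNpow, ← pow_add, add_comm]))
  have hDle : D ≤ n ^ (c + 2) := hsumle b c fun p _ => hble p
  have hDDle : D * D ≤ n ^ (2 * c + 4) :=
    (Nat.mul_le_mul hDle hDle).trans (by rw [← pow_add]; exact hpow (by omega))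
  have haDle : ∀ p, a p * (D * D) ≤ n ^ (3 * c + 4) := fun p =>
    (Nat.mul_le_mul (hale p) hDDle).trans (by rw [← pow_add]; exact hpow (by omega))
  have hkeyle : ∀ p, key p ≤ n ^ (3 * c + 4) := fun p => (Nat.div_le_self _ _).trans (haDle p)
  have hBle : B ≤ n ^ (3 * c + 6) := hsumle key _ fun p _ => hkeyle p
  have hBlt : B < n ^ (3 * c + 7) :=
    hBle.trans_lt (Nat.pow_lt_pow_right (by omega) (by omega))
  have hBn : (B + 1) * n ≤ W := by
    refine le_trans ?_ hWbig
    refine (Nat.mul_le_mul_right n hBlt).trans ?_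
    rw [← pow_succ]
    exact hpow (by omega)
  have hkeyB : ∀ p < N, key p ≤ B := fun p hp =>
    Finset.single_le_sum (f := key) (fun _ _ => Nat.zero_le _) (Finset.mem_range.mpr hp)
  have hkey2 : ∀ p < N, 2 * key p ≤ W := fun p _ =>
    (Nat.mul_le_mul_left 2 (hkeyle p)).trans ((hmul2 _).trans (hpow (by omega)))
  have hrep : KeysRepresent I key := by
    have hp : ∀ u v : Fin n, ((u : ℕ) * n + v) / n = u ∧ ((u : ℕ) * n + v) % n = v := fun u v => by
      constructor
      · rw [Nat.mul_comm, Nat.mul_add_div hn, Nat.div_eq_of_lt v.2, Nat.add_zero]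
      · rw [Nat.mul_comm, Nat.mul_add_mod, Nat.mod_eq_of_lt v.2]
    have hbuv : ∀ u v : Fin n, b (u * n + v) = den u v := fun u v => by
      simp only [hb, hp]
      exact entry_of_lt den u.2 v.2
    refine keysRepresent (D := D) hsat (fun u v => ?_) fun u v => ?_
    · rw [← hbuv]
      exact Finset.single_le_sum (f := b) (fun _ _ => Nat.zero_le _)
        (Finset.mem_range.mpr (hz.pair_lt u.2 v.2))
    · simp only [hkey, hbuv]
      congr 2
      simp only [ha, hp]
      exact entry_of_lt num u.2 v.2
  -- the start
  set σ := inputState n τ num den with hσ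
  set s₀ : AState := ⟨σ.reg, fun A i => σ.mem (A * S + i)⟩ with hs₀
  have hmem : ∀ i, 2 * N ≤ i → σ.mem i = 0 := fun i hi => inputState_mem_of_le τ num den hn hi
  have hcW : n ^ c ≤ W := hpow (by omega)
  have hSW : S ≤ W := by
    have := hz.word
    omega
  have hNW : N ≤ W := by omega
  have e1 : Exec W (.arith .mul 40 0 0) σ 1 (σ.setReg 40 N) :=
    Exec.arith σ .mul 40 0 0 (by simp) hNW
  have e2 : Exec W (.arith .mul 40 40 0) (σ.setReg 40 N) 1 ((σ.setReg 40 N).setReg 40 S) := by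
    have h := Exec.arith (W := W) (σ.setReg 40 N) .mul 40 40 0 (by simp)
    have hval : ArithOp.mul.eval ((σ.setReg 40 N).reg 40) ((σ.setReg 40 N).reg 0) = S := by
      rw [State.reg_setReg, State.reg_setReg, if_pos rfl, if_neg (by omega), hS, Nat.mul_comm]
      rfl
    rw [hval] at h
    exact h hSW
  have hsim : Sim W S ((σ.setReg 40 N).setReg 40 S) s₀ := by
    refine ⟨fun x hx => ?_, by simp [State.reg_setReg], fun A _ i _ => rfl, fun r => ?_,
      fun i => ?_⟩
    · simp [State.reg_setReg, hs₀, Nat.ne_of_lt hx]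
    · rw [State.reg_setReg, State.reg_setReg]
      split_ifs
      · exact hSW
      · simp only [hσ, inputState]
        split_ifs <;> omega
    · change σ.mem i ≤ W
      simp only [hσ, inputState]
      split_ifs
      · exact (entry_le (fun u v => (hle u v).1) _ _).trans hcW
      · exact (entry_le (fun u v => (hle u v).2) _ _).trans hcW
  have hzero : ∀ A, 0 < A → ∀ i, s₀.arr A i = 0 := fun A hA i => hmem _ (by
    have : 1 * S ≤ A * S := Nat.mul_le_mul_right _ hA
    omega)
  have hruns : Runs W S (keysProgram ;; sortProgram ;; listsProgram ;; acceptanceProgram ;;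
      iteP (var 14) (var 1) (setP 0 (lit 0)) (setP 0 (lit 1)))
      (1000 * N + (((3 * c + 7) * (1100 * N) + 10) + (1000 * N + (1000 * N + 20)))) s₀
      fun s' => s'.var 0 = 1 ↔ I.MaxFullOSM τ := by
    refine Runs.seq (Runs.mono (runs_keysProgram (τ := τ) hz (key := key) hD (fun _ _ => rfl) hB hb0
      (hDDle.trans (hpow (by omega))) (fun p _ => (haDle p).trans (hpow (by omega)))
      (hBle.trans (hpow (by omega))) rfl rfl ?_ ?_ ?_ (fun i _ => hzero 6 (by omega) i)
      (fun i _ => hzero 7 (by omega) i) (fun i _ => hzero 8 (by omega) i)) le_rfl ?_) le_rfl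
    · intro x hx
      simp [hs₀, hσ, inputState, show x ≠ 0 by omega, show x ≠ 1 by omega]
    · intro p _
      simp [hs₀, hσ, inputState, ha]
    · intro p _
      simp only [hs₀, hσ, inputState, hb, Nat.zero_mul, Nat.zero_add]
      rw [if_neg (by omega), show (2 * p + 1) / 2 = p by omega]
    rintro s₁ ⟨hs₁, hlist⟩
    refine Runs.seq (Runs.mono (runs_sortProgram hz hkeyB hBlt hBn hs₁ ?_) le_rfl ?_) le_rfl
    · rw [prefixList_congr hlist, prefixList, List.map_id']
    rintro s₂ ⟨⟨P, hs₂⟩, hperm, hsort⟩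
    refine Runs.seq (Runs.mono (runs_listsProgram hz hkey2 hs₂ hperm) le_rfl ?_) le_rfl
    rintro s₃ ⟨hs₃, h7, h8, hlists⟩
    have hp := isPrefTable_of_lists hn hperm hsort hlists
    refine Runs.seq (Runs.mono (runs_acceptanceProgram hz hp (hrep.isWitness hI hM) hs₃ h7 h8)
      le_rfl ?_) le_rfl
    rintro s₄ ⟨hτ', ptr, hold, cur, hinv⟩
    have hcount := hrep.numFully_eq hM hp hinv
    refine Runs.ite hz.word (by simp) (by simp) (fun hlt => ?_) (fun hge => ?_)
    · refine Runs.set hz.word (v := 0) rfl (by simp) ?_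
      simp only [eval_var, hτ', hcount] at hlt
      simp [hmax, hlt]
    · refine Runs.set hz.word (v := 1) rfl (by simp) ?_
      simp only [eval_var, hτ', hcount] at hge
      simp [hmax, hge]
  obtain ⟨t, σ', s', he, ht, hσ', hres⟩ := hruns _ hsim
  refine ⟨_, σ', Exec.seq e1 (Exec.seq e2 he), ?_, ?_⟩
  · rw [← hNpow]
    have h4 : 4 ≤ N := Nat.mul_le_mul h2n h2n
    have h5 : 20000 * (c + 1) * N = 20000 * (c * N) + 20000 * N := by ring
    have h6 : (3 * c + 7) * (1100 * N) = 3300 * (c * N) + 7700 * N := by ring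
    rw [h5]
    rw [h6] at ht
    omega
  · rw [hσ'.var 0 (by omega)]
    exact hres

end WordRAM

theorem mainTheorem6 :
    -- Max-Full OSM is solvable in quadratic time for strict preferences
    (∃ (P : WordRAM.Program) (K : ℕ),
      ∀ (n c τ : ℕ) (num den : Fin n → Fin n → ℕ) (I : PrefGraph (Fin n)),
        0 < n → I.Strict →
        (∀ u v, 0 < den u v ∧ I.sat u v = (num u v : ℝ) / (den u v : ℝ)) →
        (∀ u v, num u v ≤ n ^ c ∧ den u v ≤ n ^ c) → τ ≤ n ^ c →
        ∃ (t : ℕ) (s : WordRAM.State),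
          WordRAM.Exec (n ^ (K * (c + 1))) P (WordRAM.inputState n τ num den) t s ∧
          t ≤ K * (c + 1) * n ^ 2 ∧
          (s.reg 0 = 1 ↔ I.MaxFullOSM τ)) ∧
    -- the structure of the ordinally stable matchings
    (∀ (V : Type u) [Fintype V] (I : PrefGraph V), I.Strict →
      (∃ π : Equiv.Perm V, I.IsStablePartition π) ∧
      (∀ M : V → V → ℝ, I.IsOSM M →
        (∀ x y, I.MostPreferred y x → I.loadGe M x y = 1) ∧
        (∀ y, I.Matched M y ↔ I.FullyMatched M y) ∧
        (∀ π : Equiv.Perm V, I.IsStablePartition π → ∀ y, I.Matched M y ↔ π y ≠ y)) ∧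
      (∀ π : Equiv.Perm V, I.IsStablePartition π →
        I.IsOSM (partitionMatching π) ∧
        ∀ M : V → V → ℝ, I.IsOSM M → I.numFully M ≤ I.numFully (partitionMatching π))) := by
  refine ⟨⟨WordRAM.maxFullProgram, 20000, fun n c τ num den I hn hI hsat hle hτ =>
    WordRAM.maxFullProgram_spec hn hI hsat hle hτ⟩, fun V _ I hI => ?_⟩
  refine ⟨PrefGraph.exists_isStablePartition hI, fun M hM =>
    ⟨fun x y h => hM.loadGe_eq_one_of_mostPreferred hI h, hM.matched_iff_fullyMatched hI hM,
      fun π hπ y => ?_⟩, fun π hπ => ⟨hπ.isOSM, fun M hM => (hM.numFully_eq hI hπ.isOSM).le⟩⟩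
  rw [← hπ.matched_iff, hM.matched_iff_fullyMatched hI hM,
    hπ.isOSM.matched_iff_fullyMatched hI hM]
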